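/- Let $\Bbbk$ be a field. A finite category is an abelian $\Bbbk$-linear category with finitely many isomorphism classes of simple objects, finite-dimensional Hom spaces, all objects of finite length, and a projective cover for every simple object. Let $\mathcal C$ be a finite tensor category, that is, a finite category which is rigid monoidal with $\Bbbk$-bilinear tensor product and simple unit object $\mathbf 1$; for $X\in\mathcal C$ let ${}^*X$ be the dual with $\mathrm{ev}_X:X\otimes{}^*X\to\mathbf 1$ and $\mathrm{coev}_X:\mathbf 1\to{}^*X\otimes X$, and let $\phi_{X,Y}:{}^*Y\otimes{}^*X\to{}^*(X\otimes Y)$ be the canonical isomorphism. Let $\mathcal B$ be a right $\mathcal C$-module category, that is, a finite category with a coherent right action $\triangleleft:\mathcal B\times\mathcal C\to\mathcal B$ that is $\Bbbk$-bilinear and exact in each variable, and let $(F,c):\mathcal B\to\mathcal C$, $c_{B,X}:F(B\triangleleft X)\xrightarrow{\sim}F(B)\otimes X$, be a $\Bbbk$-linear, exact and faithful $\mathcal C$-module functor. Let $S(A,B)=F(B)\otimes{}^*F(A)$, with the prebalancing $\beta^X_{A,B}=(c^{-1}_{B,{}^*X}\otimes\mathrm{id})(\mathrm{id}\otimes\phi_{F(A),X}^{-1}\,{}^*(c^{-1}_{A,X})):S(A\triangleleft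 X,B)\to S(A,B\triangleleft{}^*X)$. A relative coend $C(F)=\oint^{B\in\mathcal B}F(B)\otimes{}^*F(B)$ of $(S,\beta)$ is an object of $\mathcal C$ with a dinatural transformation $\pi_B:S(B,B)\to C(F)$, universal among the dinatural transformations such that, for all $B\in\mathcal B$ and $X\in\mathcal C$, $$\pi_B\circ S(\mathrm{id}_B\triangleleft\mathrm{coev}_X,\mathrm{id}_B)=\pi_{B\triangleleft{}^*X}\circ\beta^X_{B\triangleleft{}^*X,B}$$ as morphisms $S(B\triangleleft({}^*X\otimes X),B)\to C(F)$, where associativity and unit isomorphisms are suppressed. Then: 1. The relative coend $C(F)$ exists. 2. There is a unique coalgebra structure $(\Delta,\varepsilon)$ on $C(F)$ in $\mathcal C$ such that $\varepsilon\pi_B=\mathrm{ev}_{F(B)}$ and $\Delta\pi_B=(\pi_B\otimes\pi_B)(\mathrm{id}\otimes\mathrm{coev}_{F(B)}\otimes\mathrm{id})$ for all $B\in\mathcal B$. 3. The category ${}^{C(F)}\mathcal C$ of left $C(F)$-comodules in $\mathcal C$, with the action $(W,\rho)\triangleleft Y=(W\otimes Y,\rho\otimes\mathrm{id}_Y)$,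 is a right $\mathcal C$-module category. The morphisms $\rho_A=(\pi_A\otimes\mathrm{id}_{F(A)})(\mathrm{id}_{F(A)}\otimes\mathrm{coev}_{F(A)}):F(A)\to C(F)\otimes F(A)$ define a functor $\widehat F:\mathcal B\to{}^{C(F)}\mathcal C$, $\widehat F(A)=(F(A),\rho_A)$, which is a $\mathcal C$-module functor via $c$. The module functor $(F,c)$ is the composition of $\widehat F$ with the forgetful functor ${}^{C(F)}\mathcal C\to\mathcal C$, and $\widehat F$ is an equivalence of $\mathcal C$-module categories. -/

import Mathlib

open CategoryTheory MonoidalCategory Limits Opposite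
open scoped MonoidalRightAction

universe v₁ v₂ v₃ v₄ u₁ u₂ u₃ u₄ w

namespace Reconstruction

noncomputable section

/-! ### Finite categories, finite tensor categories, module categories -/

/-- `p : P ⟶ S` is a projective cover: `P` is projective and `p` is an essential epimorphism. -/
structure IsProjectiveCover {A : Type u₁} [Category.{v₁} A] {P S : A} (p : P ⟶ S) : Prop where
  projective : Projective P
  epi : Epi p
  essential : ∀ {Q : A} (g : Q ⟶ P), Epi (g ≫ p) → Epi g

/-- A finite `k`-linear category: an abelian `k`-linear category with finitely many isomorphism
classes of simple objects, finite dimensional morphism spaces, all objects of finite length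
(that is, Artinian and Noetherian), and a projective cover for every simple object. -/
class FiniteLinearCategory (k : Type w) [Field k] (A : Type u₁) [Category.{v₁} A]
    [Preadditive A] [Linear k A] : Prop
    extends IsNormalMonoCategory A, IsNormalEpiCategory A where
  hasFiniteProducts : HasFiniteProducts A
  hasKernels : HasKernels A
  hasCokernels : HasCokernels A
  finite_simples : ∃ (n : ℕ) (S : Fin n → A), (∀ i, Simple (S i)) ∧
    ∀ X : A, Simple X → ∃ i, Nonempty (X ≅ S i)
  finiteDimensional_hom : ∀ X Y : A, FiniteDimensional k (X ⟶ Y)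
  artinian : ∀ X : A, IsArtinianObject X
  noetherian : ∀ X : A, IsNoetherianObject X
  exists_projectiveCover : ∀ S : A, Simple S → ∃ (P : A) (p : P ⟶ S), IsProjectiveCover p

/-- A finite category is abelian in the sense of Mathlib, for the given preadditive structure. -/
abbrev FiniteLinearCategory.abelian (k : Type w) [Field k] (A : Type u₁) [Category.{v₁} A]
    [Preadditive A] [Linear k A] [h : FiniteLinearCategory k A] : Abelian A where
  has_finite_products := h.hasFiniteProducts
  has_kernels := h.hasKernels
  has_cokernels := h.hasCokernels

/-- A finite tensor category: a finite `k`-linear category which is rigid monoidal, with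
`k`-bilinear tensor product and simple unit object. -/
class FiniteTensorCategory (k : Type w) [Field k] (C : Type u₁) [Category.{v₁} C]
    [Preadditive C] [Linear k C] [MonoidalCategory C] [RigidCategory C] : Prop
    extends FiniteLinearCategory k C, MonoidalPreadditive C, MonoidalLinear k C where
  simple_unit : Simple (𝟙_ C)

/-- A right `C`-module category over a finite tensor category: a finite `k`-linear category `B`
with a coherent right action of `C` which is `k`-bilinear and exact in each variable. -/
class RightModuleCategory (k : Type w) [Field k] (C : Type u₁) [Category.{v₁} C]
    [Preadditive C] [Linear k C] [MonoidalCategory C]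
    (B : Type u₂) [Category.{v₂} B] [Preadditive B] [Linear k B] [MonoidalRightAction C B] : Prop
    extends FiniteLinearCategory k B where
  additive_left : ∀ X : C, (MonoidalRightAction.actionRight B X).Additive
  linear_left : ∀ X : C, (MonoidalRightAction.actionRight B X).Linear k
  additive_right : ∀ M : B, (MonoidalRightAction.actionLeft C M).Additive
  linear_right : ∀ M : B, (MonoidalRightAction.actionLeft C M).Linear k
  leftExact_left : ∀ X : C, PreservesFiniteLimits (MonoidalRightAction.actionRight B X)
  rightExact_left : ∀ X : C, PreservesFiniteColimits (MonoidalRightAction.actionRight B X)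
  leftExact_right : ∀ M : B, PreservesFiniteLimits (MonoidalRightAction.actionLeft C M)
  rightExact_right : ∀ M : B, PreservesFiniteColimits (MonoidalRightAction.actionLeft C M)

/-! ### Module functors and equivalences of module categories

A module functor `(F, c)` is a functor `F` with an instance of `Functor.RightLinear C`; the
isomorphism `c_{M,X} : F(M ◁ X) ⟶ F(M) ◁ X` is `δᵣ F M X`. -/

section ModuleFunctors

open Functor.LaxRightLinear Functor.OplaxRightLinear Functor.RightLinear

variable {C : Type u₁} [Category.{v₁} C] [MonoidalCategory C]
  {B : Type u₂} [Category.{v₂} B] [MonoidalRightAction C B]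
  {D : Type u₃} [Category.{v₃} D] [MonoidalRightAction C D]
  {E : Type u₄} [Category.{v₄} E] [MonoidalRightAction C E]

variable (C B) in
/-- The identity module functor. -/
instance rightLinearId : (𝟭 B).RightLinear C where
  μᵣ M X := 𝟙 (M ⊙ᵣ X)
  δᵣ M X := 𝟙 (M ⊙ᵣ X)
  μᵣ_comp_δᵣ _ _ := Category.comp_id _
  δᵣ_comp_μᵣ _ _ := Category.comp_id _

/-- Composition of module functors. -/
instance rightLinearComp (F : B ⥤ D) (G : D ⥤ E) [F.RightLinear C] [G.RightLinear C] :
    (F ⋙ G).RightLinear C where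
  μᵣ M X := μᵣ G (F.obj M) X ≫ G.map (μᵣ F M X)
  δᵣ M X := G.map (δᵣ F M X) ≫ δᵣ G (F.obj M) X
  μᵣ_naturality_right M X Y f := by
    simp [← Functor.map_comp]
  μᵣ_naturality_left f X := by
    simp [← Functor.map_comp]
  μᵣ_associativity M X Y := by
    simp only [Functor.comp_map, Category.assoc, ← Functor.map_comp,
      μᵣ_associativity F]
    simp
  μᵣ_unitality M := by
    simp [← Functor.map_comp]
  δᵣ_naturality_right M X Y f := by
    simp only [Functor.comp_map, ← Functor.map_comp_assoc, δᵣ_naturality_right F]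
    simp
  δᵣ_naturality_left f X := by
    simp only [Functor.comp_map, ← Functor.map_comp_assoc, δᵣ_naturality_left F]
    simp
  δᵣ_associativity M X Y := by
    have h := congrArg G.map (δᵣ_associativity F M X Y)
    simp only [Functor.map_comp] at h
    simp only [Functor.comp_obj, Functor.comp_map, Category.assoc, δᵣ_associativity G,
      reassoc_of% h]
    simp
  δᵣ_unitality_inv M := by
    have h := congrArg G.map (δᵣ_unitality_inv F M (C := C))
    simp only [Functor.map_comp] at h
    simp only [Functor.comp_obj, Functor.comp_map, δᵣ_unitality_inv G, h, Category.assoc]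
  μᵣ_comp_δᵣ M X := by simp [← Functor.map_comp_assoc]
  δᵣ_comp_μᵣ M X := by simp [← Functor.map_comp]

variable (C) in
/-- `θ` is a natural module transformation. -/
def IsModuleNatTrans {F G : B ⥤ D} [F.RightLinear C] [G.RightLinear C] (θ : F ⟶ G) : Prop :=
  ∀ (M : B) (X : C), θ.app (M ⊙ᵣ X) ≫ δᵣ G M X = δᵣ F M X ≫ θ.app M ⊵ᵣ X

variable (C) in
/-- The `k`-linear module functor `F` is an equivalence of `C`-module categories: it has a
quasi-inverse `k`-linear module functor, up to natural module isomorphisms. -/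
def IsModuleEquivalence (k : Type w) [Field k] [Preadditive B] [Linear k B]
    [Preadditive D] [Linear k D] (F : B ⥤ D) [F.RightLinear C] : Prop :=
  F.Additive ∧ F.Linear k ∧
  ∃ (G : D ⥤ B) (_ : G.Additive) (_ : G.Linear k) (_ : G.RightLinear C)
    (e₁ : 𝟭 B ≅ F ⋙ G) (e₂ : 𝟭 D ≅ G ⋙ F),
    IsModuleNatTrans C e₁.hom ∧ IsModuleNatTrans C e₂.hom

end ModuleFunctors

/-! ### Prebalancings and relative coends -/

section RelativeCoend

variable {C : Type u₁} [Category.{v₁} C] [MonoidalCategory C] [LeftRigidCategory C]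
  {B : Type u₂} [Category.{v₂} B] [MonoidalRightAction C B]
  {A : Type u₃} [Category.{v₃} A]

variable (C) in
/-- A prebalancing of `S : Bᵒᵖ × B ⥤ A`: natural isomorphisms
`S(M ◁ X, N) ≅ S(M, N ◁ ᘁX)`, where `ᘁX` is the left dual of `X`. -/
structure Prebalancing (S : Bᵒᵖ ⥤ B ⥤ A) where
  iso (X : C) (M N : B) :
    (S.obj (op (M ⊙ᵣ X))).obj N ≅ (S.obj (op M)).obj (N ⊙ᵣ (ᘁX : C))
  naturality_first (X : C) {M M' : B} (f : M ⟶ M') (N : B) :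
    (S.map (f ⊵ᵣ X).op).app N ≫ (iso X M N).hom =
      (iso X M' N).hom ≫ (S.map f.op).app (N ⊙ᵣ (ᘁX : C))
  naturality_second (X : C) (M : B) {N N' : B} (f : N ⟶ N') :
    (S.obj (op (M ⊙ᵣ X))).map f ≫ (iso X M N').hom =
      (iso X M N).hom ≫ (S.obj (op M)).map (f ⊵ᵣ (ᘁX : C))
  naturality_acting {X Y : C} (f : X ⟶ Y) (M N : B) :
    (S.map (M ⊴ᵣ f).op).app N ≫ (iso X M N).hom =
      (iso Y M N).hom ≫ (S.obj (op M)).map (N ⊴ᵣ leftAdjointMate f)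

/-- An object `pt` with a dinatural transformation `π_N : S(N,N) ⟶ pt` that is compatible with
the prebalancing `γ`: the two morphisms `S(N ◁ (ᘁX ⊗ X), N) ⟶ pt` through `S(N, N)` and through
`S(N ◁ ᘁX, N ◁ ᘁX)` coincide. -/
structure RelativeCowedge (S : Bᵒᵖ ⥤ B ⥤ A) (γ : Prebalancing C S) where
  pt : A
  π (N : B) : (S.obj (op N)).obj N ⟶ pt
  dinatural {M N : B} (f : M ⟶ N) :
    (S.map f.op).app M ≫ π M = (S.obj (op N)).map f ≫ π N
  balanced (N : B) (X : C) :
    (S.map (N ⊴ᵣ ExactPairing.coevaluation (ᘁX : C) X).op).app N ≫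
        (S.map (ρᵣ[C] N).inv.op).app N ≫ π N =
      (S.map (αᵣ N (ᘁX : C) X).inv.op).app N ≫
        (γ.iso X (N ⊙ᵣ (ᘁX : C)) N).hom ≫ π (N ⊙ᵣ (ᘁX : C))

/-- The relative cowedge `K` is a relative coend of `(S, γ)`. -/
def RelativeCowedge.IsCoend {S : Bᵒᵖ ⥤ B ⥤ A} {γ : Prebalancing C S}
    (K : RelativeCowedge S γ) : Prop :=
  ∀ L : RelativeCowedge S γ, ∃! g : K.pt ⟶ L.pt, ∀ N : B, K.π N ≫ g = L.π N

end RelativeCoend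

/-! ### The canonical prebalancing of `(A, B) ↦ F(B) ⊗ ᘁF(A)` -/

section Canonical

open Functor.LaxRightLinear Functor.OplaxRightLinear Functor.RightLinear

variable {C : Type u₁} [Category.{v₁} C] [MonoidalCategory C]

/-- The exact pairing of `ᘁY ⊗ ᘁX` and `X ⊗ Y`, whose evaluation is
`ev_X ∘ (id ⊗ ev_Y ⊗ id) : (X ⊗ Y) ⊗ (ᘁY ⊗ ᘁX) ⟶ 𝟙`. -/
abbrev tensorPairing (X Y : C) [HasLeftDual X] [HasLeftDual Y] :
    ExactPairing ((ᘁY : C) ⊗ (ᘁX : C)) (X ⊗ Y) :=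
  ExactPairing.tensor

lemma leftAdjointMate_eq_of_evaluation {X Y : C} [HasLeftDual X] [HasLeftDual Y] (f : X ⟶ Y)
    (g : (ᘁY : C) ⟶ (ᘁX : C))
    (h : X ◁ g ≫ ExactPairing.evaluation (ᘁX : C) X =
      f ▷ (ᘁY : C) ≫ ExactPairing.evaluation (ᘁY : C) Y) :
    leftAdjointMate f = g := by
  have h' := (leftAdjointMate_comp_evaluation f).trans h.symm
  have := congrArg (tensorLeftHomEquiv _ (ᘁX : C) X _) h'
  rw [tensorLeftHomEquiv_whiskerLeft_comp_evaluation,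
    tensorLeftHomEquiv_whiskerLeft_comp_evaluation] at this
  exact (cancel_mono _).1 this

variable [LeftRigidCategory C]

/-- The canonical isomorphism `φ_{X,Y} : ᘁY ⊗ ᘁX ≅ ᘁ(X ⊗ Y)`. -/
def dualTensorIso (X Y : C) : (ᘁY : C) ⊗ (ᘁX : C) ≅ (ᘁ(X ⊗ Y) : C) :=
  leftDualIso (tensorPairing X Y) HasLeftDual.exact

/-- The defining property of `φ_{X,Y}`: it is compatible with the evaluations. -/
lemma dualTensorIso_hom_evaluation (X Y : C) :
    (X ⊗ Y) ◁ (dualTensorIso X Y).hom ≫ ExactPairing.evaluation (ᘁ(X ⊗ Y) : C) (X ⊗ Y) =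
      (tensorPairing X Y).evaluation' := by
  have := @leftAdjointMate_comp_evaluation C _ _ (X ⊗ Y) (X ⊗ Y) inferInstance
    (hasLeftDualTensor) (𝟙 _)
  simp only [id_whiskerRight, Category.id_comp] at this
  exact this

lemma tensorPairing_naturality {X X' Y Y' : C} (f : X ⟶ X') (g : Y ⟶ Y') :
    (X ⊗ Y) ◁ (leftAdjointMate g ⊗ₘ leftAdjointMate f) ≫ (tensorPairing X Y).evaluation' =
      (f ⊗ₘ g) ▷ _ ≫ (tensorPairing X' Y').evaluation' := by
  change _ ≫ (𝟙 _ ⊗≫ X ◁ (ExactPairing.evaluation (ᘁY : C) Y ▷ (ᘁX : C)) ⊗≫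
      ExactPairing.evaluation (ᘁX : C) X) =
    _ ≫ (𝟙 _ ⊗≫ X' ◁ (ExactPairing.evaluation (ᘁY' : C) Y' ▷ (ᘁX' : C)) ⊗≫
      ExactPairing.evaluation (ᘁX' : C) X')
  calc
    _ = 𝟙 _ ⊗≫ (X ⊗ Y ⊗ (ᘁY' : C)) ◁ leftAdjointMate f ⊗≫
          X ◁ ((Y ◁ leftAdjointMate g ≫ ExactPairing.evaluation (ᘁY : C) Y) ▷ (ᘁX : C)) ⊗≫
          ExactPairing.evaluation (ᘁX : C) X := by
        rw [MonoidalCategory.tensorHom_def']; monoidal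
    _ = 𝟙 _ ⊗≫ X ◁ ((Y ⊗ (ᘁY' : C)) ◁ leftAdjointMate f ≫
          (g ▷ (ᘁY' : C) ≫ ExactPairing.evaluation (ᘁY' : C) Y') ▷ (ᘁX : C)) ⊗≫
          ExactPairing.evaluation (ᘁX : C) X := by
        rw [leftAdjointMate_comp_evaluation]; monoidal
    _ = 𝟙 _ ⊗≫ X ◁ ((g ▷ (ᘁY' : C) ≫ ExactPairing.evaluation (ᘁY' : C) Y') ▷ (ᘁX' : C)) ⊗≫
          (X ◁ leftAdjointMate f ≫ ExactPairing.evaluation (ᘁX : C) X) := by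
        rw [whisker_exchange]; monoidal
    _ = 𝟙 _ ⊗≫ (X ◁ ((g ▷ (ᘁY' : C) ≫ ExactPairing.evaluation (ᘁY' : C) Y') ▷ (ᘁX' : C)) ≫
          f ▷ (𝟙_ C ⊗ (ᘁX' : C))) ⊗≫ ExactPairing.evaluation (ᘁX' : C) X' := by
        rw [leftAdjointMate_comp_evaluation]; monoidal
    _ = _ := by
        rw [whisker_exchange, MonoidalCategory.tensorHom_def]; monoidal

lemma dualTensorIso_naturality {X X' Y Y' : C} (f : X ⟶ X') (g : Y ⟶ Y') :
    (leftAdjointMate g ⊗ₘ leftAdjointMate f) ≫ (dualTensorIso X Y).hom =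
      (dualTensorIso X' Y').hom ≫ leftAdjointMate (f ⊗ₘ g) := by
  rw [← Iso.inv_comp_eq]
  symm
  apply leftAdjointMate_eq_of_evaluation
  rw [whiskerLeft_comp, whiskerLeft_comp, Category.assoc, Category.assoc,
    dualTensorIso_hom_evaluation, tensorPairing_naturality, whisker_exchange_assoc,
    ← dualTensorIso_hom_evaluation, ← whiskerLeft_comp_assoc, Iso.inv_hom_id]
  simp

variable {B : Type u₂} [Category.{v₂} B] [MonoidalRightAction C B]

/-- The functor `S^F(A, B) = F(B) ⊗ ᘁF(A)`. -/
@[simps]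
def coendFunctor (F : B ⥤ C) : Bᵒᵖ ⥤ B ⥤ C where
  obj A :=
    { obj := fun N => F.obj N ⊗ (ᘁ(F.obj A.unop) : C)
      map := fun f => F.map f ▷ _ }
  map g :=
    { app := fun N => F.obj N ◁ leftAdjointMate (F.map g.unop)
      naturality := fun _ _ _ => whisker_exchange _ _ |>.symm }
  map_id A := by ext; simp
  map_comp f g := by
    ext
    simp [comp_leftAdjointMate]

/-- The dual of an isomorphism. -/
@[simps]
def leftDualMapIso {X Y : C} (e : X ≅ Y) : (ᘁY : C) ≅ (ᘁX : C) where
  hom := leftAdjointMate e.hom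
  inv := leftAdjointMate e.inv
  hom_inv_id := by rw [← comp_leftAdjointMate, e.inv_hom_id, leftAdjointMate_id]
  inv_hom_id := by rw [← comp_leftAdjointMate, e.hom_inv_id, leftAdjointMate_id]

/-- The isomorphism `φ⁻¹ ∘ ᘁ(c⁻¹) : ᘁF(A ◁ X) ≅ ᘁX ⊗ ᘁF(A)`. -/
def dualActionIso (F : B ⥤ C) [F.RightLinear C] (A : B) (X : C) :
    (ᘁ(F.obj (A ⊙ᵣ X)) : C) ≅ (ᘁX : C) ⊗ (ᘁ(F.obj A) : C) :=
  leftDualMapIso (μᵣIso F A X) ≪≫ (dualTensorIso (F.obj A) X).symm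

lemma dualActionIso_naturality (F : B ⥤ C) [F.RightLinear C] {A A' : B} {X X' : C}
    (f : A ⟶ A') (g : X ⟶ X') :
    leftAdjointMate (F.map (f ⊙ᵣₘ g)) ≫ (dualActionIso F A X).hom =
      (dualActionIso F A' X').hom ≫ (leftAdjointMate g ⊗ₘ leftAdjointMate (F.map f)) := by
  have h : (F.map f ⊗ₘ g) ≫ μᵣ F A' X' = μᵣ F A X ≫ F.map (f ⊙ᵣₘ g) := by
    have h₁ := μᵣ_naturality_left F f X
    have h₂ := μᵣ_naturality_right F A' g
    rw [MonoidalRightAction.actionHom_def, F.map_comp, ← reassoc_of% h₁, ← h₂,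
      MonoidalCategory.tensorHom_def, Category.assoc]
    rfl
  simp only [dualActionIso, Iso.trans_hom, Iso.symm_hom, leftDualMapIso_hom, Category.assoc]
  rw [← cancel_mono (dualTensorIso (F.obj A) X).hom]
  simp only [Category.assoc, Iso.inv_hom_id, Category.comp_id]
  rw [dualTensorIso_naturality, Iso.inv_hom_id_assoc]
  exact (comp_leftAdjointMate.symm.trans ((congrArg leftAdjointMate h.symm))).trans
    comp_leftAdjointMate

/-- The isomorphism
`(c⁻¹ ⊗ id) ∘ (id ⊗ φ⁻¹ ∘ ᘁ(c⁻¹)) : F(N) ⊗ ᘁF(M ◁ X) ⟶ F(N ◁ ᘁX) ⊗ ᘁF(M)`. -/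
def coendPrebalancingIso (F : B ⥤ C) [F.RightLinear C] (X : C) (M N : B) :
    F.obj N ⊗ (ᘁ(F.obj (M ⊙ᵣ X)) : C) ≅ F.obj (N ⊙ᵣ (ᘁX : C)) ⊗ (ᘁ(F.obj M) : C) :=
  whiskerLeftIso (F.obj N) (dualActionIso F M X) ≪≫
    (α_ (F.obj N) (ᘁX : C) (ᘁ(F.obj M) : C)).symm ≪≫
    whiskerRightIso (μᵣIso F N (ᘁX : C)) (ᘁ(F.obj M) : C)

lemma coendPrebalancingIso_hom (F : B ⥤ C) [F.RightLinear C] (X : C) (M N : B) :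
    (coendPrebalancingIso F X M N).hom = F.obj N ◁ (dualActionIso F M X).hom ≫
      (α_ (F.obj N) (ᘁX : C) (ᘁ(F.obj M) : C)).inv ≫ μᵣ F N (ᘁX : C) ▷ (ᘁ(F.obj M) : C) :=
  rfl

/-- The canonical prebalancing of `S^F`. -/
def coendPrebalancing (F : B ⥤ C) [F.RightLinear C] : Prebalancing C (coendFunctor F) where
  iso X M N := coendPrebalancingIso F X M N
  naturality_first X M M' f N := by
    have h := dualActionIso_naturality F f (𝟙 X)
    rw [MonoidalRightAction.actionHom_id, leftAdjointMate_id, id_tensorHom] at h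
    have h' := congrArg (F.obj N ◁ ·) h
    simp only [whiskerLeft_comp] at h'
    change F.obj N ◁ leftAdjointMate (F.map (f ⊵ᵣ X)) ≫ (coendPrebalancingIso F X M N).hom =
      (coendPrebalancingIso F X M' N).hom ≫ F.obj (N ⊙ᵣ (ᘁX : C)) ◁ leftAdjointMate (F.map f)
    rw [coendPrebalancingIso_hom, coendPrebalancingIso_hom, reassoc_of% h', Category.assoc,
      Category.assoc, associator_inv_naturality_right_assoc, whisker_exchange]
  naturality_second X M N N' f := by
    have h : F.map f ▷ (ᘁX : C) ≫ μᵣ F N' (ᘁX : C) = μᵣ F N (ᘁX : C) ≫ F.map (f ⊵ᵣ (ᘁX : C)) :=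
      μᵣ_naturality_left F f (ᘁX : C)
    have h' := congrArg (· ▷ (ᘁ(F.obj M) : C)) h
    simp only [comp_whiskerRight] at h'
    change F.map f ▷ _ ≫ (coendPrebalancingIso F X M N').hom =
      (coendPrebalancingIso F X M N).hom ≫ F.map (f ⊵ᵣ (ᘁX : C)) ▷ _
    rw [coendPrebalancingIso_hom, coendPrebalancingIso_hom, ← whisker_exchange_assoc,
      associator_inv_naturality_left_assoc, h', Category.assoc, Category.assoc]
  naturality_acting {X Y} f M N := by
    have h := dualActionIso_naturality F (𝟙 M) f
    rw [MonoidalRightAction.id_actionHom, F.map_id, leftAdjointMate_id, tensorHom_id] at h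
    have h' := congrArg (F.obj N ◁ ·) h
    simp only [whiskerLeft_comp] at h'
    have h₁ : F.obj N ◁ leftAdjointMate f ≫ μᵣ F N (ᘁX : C) =
        μᵣ F N (ᘁY : C) ≫ F.map (N ⊴ᵣ leftAdjointMate f) :=
      μᵣ_naturality_right F N (leftAdjointMate f)
    have h₂ := congrArg (· ▷ (ᘁ(F.obj M) : C)) h₁
    simp only [comp_whiskerRight] at h₂
    change F.obj N ◁ leftAdjointMate (F.map (M ⊴ᵣ f)) ≫ (coendPrebalancingIso F X M N).hom =
      (coendPrebalancingIso F Y M N).hom ≫ F.map (N ⊴ᵣ leftAdjointMate f) ▷ _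
    rw [coendPrebalancingIso_hom, coendPrebalancingIso_hom, reassoc_of% h',
      associator_inv_naturality_middle_assoc, h₂, Category.assoc, Category.assoc]

end Canonical

/-! ### Comodules over a coalgebra -/

section Comodules

variable {C : Type u₁} [Category.{v₁} C] [MonoidalCategory C]

/-- Left comodules in `C` over a coalgebra (comonoid object) `H`. -/
structure LeftComod (H : C) [ComonObj H] where
  X : C
  coact : X ⟶ H ⊗ X
  counit_coact : coact ≫ ComonObj.counit ▷ X = (λ_ X).inv
  coassoc : coact ≫ H ◁ coact = coact ≫ ComonObj.comul ▷ X ≫ (α_ H H X).hom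

namespace LeftComod

variable {H : C} [ComonObj H]

/-- Morphisms of left comodules. -/
@[ext]
structure Hom (M N : LeftComod H) where
  hom : M.X ⟶ N.X
  comm : M.coact ≫ H ◁ hom = hom ≫ N.coact

attribute [simp] Hom.comm

@[simps]
instance : Category (LeftComod H) where
  Hom M N := Hom M N
  id M := ⟨𝟙 M.X, by simp⟩
  comp f g := ⟨f.hom ≫ g.hom, by
    rw [whiskerLeft_comp, ← Category.assoc, f.comm, Category.assoc, g.comm, Category.assoc]⟩

@[ext]
lemma hom_ext {M N : LeftComod H} {f g : M ⟶ N} (h : f.hom = g.hom) : f = g := Hom.ext h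

variable (H) in
/-- The forgetful functor from comodules to `C`. -/
@[simps]
def forget : LeftComod H ⥤ C where
  obj M := M.X
  map f := f.hom

/-- An isomorphism of comodules from an isomorphism of the underlying objects. -/
@[simps]
def mkIso {M N : LeftComod H} (e : M.X ≅ N.X) (h : M.coact ≫ H ◁ e.hom = e.hom ≫ N.coact) :
    M ≅ N where
  hom := ⟨e.hom, h⟩
  inv := ⟨e.inv, by
    rw [Iso.eq_inv_comp, ← reassoc_of% h, ← whiskerLeft_comp, e.hom_inv_id]; simp⟩

/-- The comodule `M ◁ Y`: the object `M ⊗ Y` with coaction `ρ_M ⊗ id_Y`. -/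
@[simps]
def tensorRight (M : LeftComod H) (Y : C) : LeftComod H where
  X := M.X ⊗ Y
  coact := M.coact ▷ Y ≫ (α_ H M.X Y).hom
  counit_coact := by
    have h := congrArg (· ▷ Y) M.counit_coact
    simp only [comp_whiskerRight] at h
    rw [Category.assoc, ← associator_naturality_left, reassoc_of% h, leftUnitor_tensor_inv]
  coassoc := by
    have h := congrArg (· ▷ Y) M.coassoc
    simp only [comp_whiskerRight, whisker_assoc] at h
    have h' := h =≫ ((α_ H (H ⊗ M.X) Y).hom ≫ H ◁ (α_ H M.X Y).hom)
    simpa using h'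

lemma coact_tensorHom {H M N Y Z : C} (ρ : M ⟶ H ⊗ M) (σ : N ⟶ H ⊗ N) (f : M ⟶ N)
    (hf : ρ ≫ H ◁ f = f ≫ σ) (g : Y ⟶ Z) :
    (ρ ▷ Y ≫ (α_ H M Y).hom) ≫ H ◁ (f ⊗ₘ g) = (f ⊗ₘ g) ≫ σ ▷ Z ≫ (α_ H N Z).hom := by
  have h := congrArg (· ▷ Z) hf
  simp only [comp_whiskerRight] at h
  rw [MonoidalCategory.tensorHom_def']
  simp only [Category.assoc, whiskerLeft_comp, ← associator_naturality_right_assoc, ← whisker_exchange_assoc, ← associator_naturality_middle,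
    reassoc_of% h]

/-- The right action of `C` on left comodules. -/
@[simps]
instance rightAction : MonoidalRightAction C (LeftComod H) where
  actionObj M Y := M.tensorRight Y
  actionHomRight M _ _ f := ⟨M.X ◁ f, by
    have h := coact_tensorHom M.coact M.coact (𝟙 M.X) (by simp) f
    rwa [id_tensorHom] at h⟩
  actionHomLeft f Y := ⟨f.hom ▷ Y, by
    have h := coact_tensorHom _ _ f.hom f.comm (𝟙 Y)
    rwa [tensorHom_id] at h⟩
  actionHom f g := ⟨f.hom ⊗ₘ g, coact_tensorHom _ _ f.hom f.comm g⟩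
  actionAssocIso M Y Z := mkIso (α_ M.X Y Z).symm (by
    change (M.coact ▷ (Y ⊗ Z) ≫ (α_ H M.X (Y ⊗ Z)).hom) ≫ H ◁ (α_ M.X Y Z).inv =
      (α_ M.X Y Z).inv ≫ (M.coact ▷ Y ≫ (α_ H M.X Y).hom) ▷ Z ≫ (α_ H (M.X ⊗ Y) Z).hom
    simp)
  actionUnitIso M := mkIso (ρ_ M.X) (by
    change (M.coact ▷ 𝟙_ C ≫ (α_ H M.X (𝟙_ C)).hom) ≫ H ◁ (ρ_ M.X).hom = (ρ_ M.X).hom ≫ M.coact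
    simp)
  actionHom_def f g := hom_ext (MonoidalCategory.tensorHom_def _ _)
  actionHomRight_id _ _ := hom_ext (whiskerLeft_id _ _)
  id_actionHomLeft _ _ := hom_ext (id_whiskerRight _ _)
  actionHom_comp _ _ _ _ := hom_ext (tensorHom_comp_tensorHom _ _ _ _).symm
  actionAssocIso_hom_naturality _ _ _ := hom_ext (associator_inv_naturality _ _ _)
  actionUnitIso_hom_naturality _ := hom_ext (rightUnitor_naturality _).symm
  actionHomRight_whiskerRight {Y Y'} f Z M := hom_ext (by
    change M.X ◁ f ▷ Z = (α_ M.X Y Z).inv ≫ (M.X ◁ f) ▷ Z ≫ (α_ M.X Y' Z).hom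
    simp)
  whiskerRight_actionHomLeft Y {Z Z'} f M := hom_ext (by
    change M.X ◁ Y ◁ f = (α_ M.X Y Z).inv ≫ (M.X ⊗ Y) ◁ f ≫ (α_ M.X Y Z').hom
    simp)
  actionHom_associator X Y Z M := hom_ext (by
    change M.X ◁ (α_ X Y Z).hom ≫ (α_ M.X X (Y ⊗ Z)).inv ≫ (α_ (M.X ⊗ X) Y Z).inv =
      (α_ M.X (X ⊗ Y) Z).inv ≫ (α_ M.X X Y).inv ▷ Z
    simp)
  actionHom_leftUnitor X M := hom_ext (by
    change M.X ◁ (λ_ X).hom = (α_ M.X (𝟙_ C) X).inv ≫ (ρ_ M.X).hom ▷ X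
    simp)
  actionHom_rightUnitor X M := hom_ext (by
    change M.X ◁ (ρ_ X).hom = (α_ M.X X (𝟙_ C)).inv ≫ (ρ_ (M.X ⊗ X)).hom
    simp)

/-- The forgetful functor is a (strict) module functor. -/
instance : (forget H).RightLinear C where
  μᵣ M X := 𝟙 (M.X ⊗ X)
  μᵣ_naturality_right _ _ _ _ := (Category.comp_id _).trans (Category.id_comp _).symm
  μᵣ_naturality_left _ _ := (Category.comp_id _).trans (Category.id_comp _).symm
  μᵣ_associativity M X Y := (Category.id_comp _).trans (by
    change (α_ M.X X Y).inv = (α_ M.X X Y).inv ≫ 𝟙 (M.X ⊗ X) ▷ Y ≫ 𝟙 _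
    simp)
  μᵣ_unitality _ := (Category.id_comp _).symm
  δᵣ M X := 𝟙 (M.X ⊗ X)
  δᵣ_naturality_right _ _ _ _ := (Category.comp_id _).trans (Category.id_comp _).symm
  δᵣ_naturality_left _ _ := (Category.comp_id _).trans (Category.id_comp _).symm
  δᵣ_associativity M X Y := (Category.id_comp _).trans (by
    change (α_ M.X X Y).inv = (α_ M.X X Y).inv ≫ 𝟙 _ ≫ 𝟙 (M.X ⊗ X) ▷ Y
    simp)
  δᵣ_unitality_inv _ := (Category.comp_id _).symm
  μᵣ_comp_δᵣ _ _ := Category.comp_id _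
  δᵣ_comp_μᵣ _ _ := Category.comp_id _

section Linear

variable [Preadditive C] [MonoidalPreadditive C]

instance (M N : LeftComod H) : Add (M ⟶ N) := ⟨fun f g => ⟨f.hom + g.hom, by simp⟩⟩

instance (M N : LeftComod H) : Zero (M ⟶ N) := ⟨⟨0, by simp⟩⟩

instance (M N : LeftComod H) : Neg (M ⟶ N) :=
  ⟨fun f => ⟨-f.hom, by
    have h := (MonoidalCategory.tensorLeft H).map_neg (f := f.hom)
    change H ◁ (-f.hom) = -(H ◁ f.hom) at h
    simp [h]⟩⟩

instance (M N : LeftComod H) : AddCommGroup (M ⟶ N) where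
  add_assoc f g h := hom_ext (add_assoc _ _ _)
  zero_add f := hom_ext (zero_add _)
  add_zero f := hom_ext (add_zero _)
  neg_add_cancel f := hom_ext (neg_add_cancel _)
  add_comm f g := hom_ext (add_comm _ _)
  nsmul := nsmulRec
  zsmul := zsmulRec

instance : Preadditive (LeftComod H) where
  add_comp _ _ _ _ _ _ := hom_ext (Preadditive.add_comp _ _ _ _ _ _)
  comp_add _ _ _ _ _ _ := hom_ext (Preadditive.comp_add _ _ _ _ _ _)

variable {k : Type w} [Field k] [Linear k C] [MonoidalLinear k C]

instance (M N : LeftComod H) : Module k (M ⟶ N) where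
  smul r f := ⟨r • f.hom, by simp⟩
  one_smul _ := hom_ext (one_smul _ _)
  mul_smul _ _ _ := hom_ext (mul_smul _ _ _)
  smul_zero _ := hom_ext (smul_zero _)
  smul_add _ _ _ := hom_ext (smul_add _ _ _)
  add_smul _ _ _ := hom_ext (add_smul _ _ _)
  zero_smul _ := hom_ext (zero_smul _ _)

instance : Linear k (LeftComod H) where
  smul_comp _ _ _ _ _ _ := hom_ext (Linear.smul_comp _ _ _ _ _ _)
  comp_smul _ _ _ _ _ _ := hom_ext (Linear.comp_smul _ _ _ _ _ _)

end Linear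

end LeftComod

end Comodules

/-! ### The coalgebra `C(F)` and the factorization of `F` through its comodules -/

section Factorization

open Functor.LaxRightLinear Functor.OplaxRightLinear Functor.RightLinear

variable {C : Type u₁} [Category.{v₁} C] [MonoidalCategory C]
  {B : Type u₂} [Category.{v₂} B] [MonoidalRightAction C B]

section Coalgebra

variable [LeftRigidCategory C] {F : B ⥤ C} [F.RightLinear C]

/-- The component `F(A) ⊗ ᘁF(A) ⟶ K` of a relative cowedge of `S^F`. -/
def leg (K : RelativeCowedge (coendFunctor F) (coendPrebalancing F)) (A : B) :
    F.obj A ⊗ (ᘁ(F.obj A) : C) ⟶ K.pt :=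
  K.π A

/-- The coalgebra structure on `K` is the one determined by `ε ∘ π_A = ev_{F(A)}` and
`Δ ∘ π_A = (π_A ⊗ π_A) ∘ (id ⊗ coev_{F(A)} ⊗ id)`. -/
structure IsCoendCoalgebra (K : RelativeCowedge (coendFunctor F) (coendPrebalancing F))
    (H : ComonObj K.pt) : Prop where
  counit (A : B) :
    leg K A ≫ H.counit = ExactPairing.evaluation (ᘁ(F.obj A) : C) (F.obj A)
  comul (A : B) :
    leg K A ≫ H.comul =
      F.obj A ◁ ((λ_ _).inv ≫
          ExactPairing.coevaluation (ᘁ(F.obj A) : C) (F.obj A) ▷ (ᘁ(F.obj A) : C) ≫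
          (α_ _ _ _).hom) ≫
        (α_ (F.obj A) (ᘁ(F.obj A) : C) (F.obj A ⊗ (ᘁ(F.obj A) : C))).inv ≫
        (leg K A ⊗ₘ leg K A)

/-- The morphism `ρ_A = (π_A ⊗ id) ∘ (id ⊗ coev_{F(A)}) : F(A) ⟶ K ⊗ F(A)`. -/
def coendCoaction (K : RelativeCowedge (coendFunctor F) (coendPrebalancing F)) (A : B) :
    F.obj A ⟶ K.pt ⊗ F.obj A :=
  (ρ_ (F.obj A)).inv ≫
    F.obj A ◁ ExactPairing.coevaluation (ᘁ(F.obj A) : C) (F.obj A) ≫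
    (α_ (F.obj A) (ᘁ(F.obj A) : C) (F.obj A)).inv ≫ leg K A ▷ F.obj A

end Coalgebra

/-- The data of a factorization of the module functor `(F, c)` through the category of left
`H`-comodules: natural coactions of `H` on the objects `F(A)`, for which the isomorphisms `c` are
comodule morphisms. -/
structure ComoduleLift (F : B ⥤ C) [F.RightLinear C] (H : C) [ComonObj H] where
  coact (A : B) : F.obj A ⟶ H ⊗ F.obj A
  counit_coact (A : B) : coact A ≫ ComonObj.counit ▷ F.obj A = (λ_ (F.obj A)).inv
  coassoc (A : B) : coact A ≫ H ◁ coact A =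
    coact A ≫ ComonObj.comul ▷ F.obj A ≫ (α_ H H (F.obj A)).hom
  naturality {A A' : B} (f : A ⟶ A') : coact A ≫ H ◁ F.map f = F.map f ≫ coact A'
  linear (A : B) (X : C) : coact (A ⊙ᵣ X) ≫ H ◁ (δᵣ F A X : F.obj (A ⊙ᵣ X) ⟶ F.obj A ⊗ X) =
    (δᵣ F A X : F.obj (A ⊙ᵣ X) ⟶ F.obj A ⊗ X) ≫ coact A ▷ X ≫ (α_ H (F.obj A) X).hom

namespace ComoduleLift

variable {F : B ⥤ C} [F.RightLinear C] {H : C} [ComonObj H] (L : ComoduleLift F H)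

/-- The functor `A ↦ (F(A), ρ_A)` to comodules. -/
@[simps]
def functor : B ⥤ LeftComod H where
  obj A := ⟨F.obj A, L.coact A, L.counit_coact A, L.coassoc A⟩
  map f := ⟨F.map f, L.naturality f⟩

/-- The isomorphism of comodules `c_{A,X} : (F(A ◁ X), ρ) ≅ (F(A), ρ) ◁ X`. -/
def linearIso (A : B) (X : C) : L.functor.obj (A ⊙ᵣ X) ≅ L.functor.obj A ⊙ᵣ X :=
  LeftComod.mkIso (M := L.functor.obj (A ⊙ᵣ X)) (N := L.functor.obj A ⊙ᵣ X)
    (μᵣIso F A X).symm (L.linear A X)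

/-- The module functor structure on `A ↦ (F(A), ρ_A)` given by `c`. -/
instance : L.functor.RightLinear C where
  μᵣ A X := (L.linearIso A X).inv
  μᵣ_naturality_right A _ _ f := LeftComod.hom_ext (μᵣ_naturality_right F A f)
  μᵣ_naturality_left f X := LeftComod.hom_ext (μᵣ_naturality_left F f X)
  μᵣ_associativity A X Y := LeftComod.hom_ext (μᵣ_associativity F A X Y)
  μᵣ_unitality A := LeftComod.hom_ext (μᵣ_unitality (C := C) F A)
  δᵣ A X := (L.linearIso A X).hom
  δᵣ_naturality_right A _ _ f := LeftComod.hom_ext (δᵣ_naturality_right F A f)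
  δᵣ_naturality_left f X := LeftComod.hom_ext (δᵣ_naturality_left F f X)
  δᵣ_associativity A X Y := LeftComod.hom_ext (δᵣ_associativity F A X Y)
  δᵣ_unitality_inv A := LeftComod.hom_ext (δᵣ_unitality_inv (C := C) F A)
  μᵣ_comp_δᵣ A X := (L.linearIso A X).inv_hom_id
  δᵣ_comp_μᵣ A X := (L.linearIso A X).hom_inv_id

end ComoduleLift

end Factorization

end

end Reconstruction

open Reconstruction

/-!
The proof describes everything through the right adjoint of `F`.

The functor `Hom(F -, 𝟙)` on the finite category `B` is left exact with finite dimensional values,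
hence it is representable: there are an object `U` and a morphism `e : F(U) ⟶ 𝟙` through which
every morphism `F(A) ⟶ 𝟙` factors as `e ∘ F(f)` for a unique `f` (`exists_universal_element`). As
`C` is rigid and `F` is a module functor, the induced morphism `F(U ◁ X) ≅ F(U) ⊗ X ⟶ X` is then
universal for every `X` (`inducedCounit_universal`), which means that `X ↦ U ◁ X` is right adjoint
to `F`.

Under the duality `Hom(F(A) ⊗ ᘁF(A), Z) ≃ Hom(F(A), Z ⊗ F(A))`, the dinatural transformations to
`Z` correspond to the natural transformations `F ⟶ Z ⊗ F(-)`, and the compatibility with the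
prebalancing for `(N, X)` to the compatibility with the action for `(N, ᘁX)`
(`balanced_iff_linear`). Since every object of `C` is a left dual, a relative cowedge is the same
thing as a transformation `F ⟶ Z ⊗ F(-)` of module functors. By the adjunction these are the
morphisms `F(U) ⟶ Z`, so that `F(U)` is the relative coend (`exists_isCoend`).

The equations which define `Δ` and `ε` say that the universal transformation `ρ : F ⟶ C(F) ⊗ F(-)`
is coassociative and counital (`isCoendCoalgebra_iff`), and the coalgebra axioms follow from the
universal property. The comonad of the adjunction is `X ↦ F(U ◁ X) ≅ C(F) ⊗ X`, whose coalgebras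
are the `C(F)`-comodules; as `F` is exact and faithful, the argument of Beck's theorem shows that
`A ↦ (F(A), ρ_A)` is an equivalence (`ComoduleLift.isEquivalence_functor`). Its quasi-inverse
inherits a module structure (`isModuleEquivalence_functor`), and the finiteness and exactness
properties of the category of comodules are transported from `B`
(`rightModuleCategory_of_equivalence`).
-/

namespace Reconstruction

/-! ### Representability of left exact functors on a finite category -/

section Representability

variable (k : Type w) [Field k] {B : Type u₂} [Category.{v₂} B] [Preadditive B] [Linear k B]

/-- The direct sum of the projective covers of the simple objects. -/
lemma exists_projective_detecting_zero [FiniteLinearCategory k B] :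
    ∃ P : B, Projective P ∧ ∀ Q : B, (∀ f : P ⟶ Q, f = 0) → IsZero Q := by
  let _ := FiniteLinearCategory.abelian k B
  obtain ⟨n, S, hS, hS'⟩ := FiniteLinearCategory.finite_simples k (A := B)
  choose P p hp using fun i => FiniteLinearCategory.exists_projectiveCover k (S i) (hS i)
  have := Abelian.hasFiniteBiproducts (C := B)
  have := fun i => (hp i).projective
  have := fun i => (hp i).epi
  have hproj : Projective (⨁ P) :=
    ⟨fun f g _ => ⟨biproduct.desc fun i => Projective.factorThru (biproduct.ι P i ≫ f) g, by
      ext i; simp⟩⟩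
  refine ⟨⨁ P, hproj, fun Q hQ => ?_⟩
  by_contra hne
  have := FiniteLinearCategory.artinian k Q
  obtain ⟨i, ⟨e⟩⟩ := hS' (simpleSubobject hne) inferInstance
  have h := hQ (biproduct.π P i ≫ p i ≫ e.inv ≫ simpleSubobjectArrow hne)
  have h₁ : simpleSubobjectArrow hne = 0 := by
    simpa [← cancel_epi (biproduct.π P i ≫ p i ≫ e.inv)] using h
  exact Simple.not_isZero (simpleSubobject hne)
    (IsZero.of_mono_eq_zero _ h₁)

variable {C : Type u₁} [Category.{v₁} C] [Preadditive C]

include k in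
/-- An element `y` of the left exact functor `Hom(F -, X)` comes from an element of a quotient
which is not killed by any nonzero morphism: divide by the largest subobject that kills `y`. -/
lemma exists_minimal_element [FiniteLinearCategory k B] (F : B ⥤ C) [F.Additive]
    [PreservesFiniteColimits F] {X : C} (A : B) (y : F.obj A ⟶ X) :
    ∃ (A' : B) (q : A ⟶ A') (y' : F.obj A' ⟶ X), F.map q ≫ y' = y ∧
      ∀ {Z : B} (f : Z ⟶ A'), F.map f ≫ y' = 0 → f = 0 := by
  let _ := FiniteLinearCategory.abelian k B
  have := FiniteLinearCategory.noetherian k A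
  -- right exactness: `y` descends to the cokernel of each morphism which kills it
  have desc : ∀ {K Y : B} (g : K ⟶ Y) (z : F.obj Y ⟶ X), F.map g ≫ z = 0 →
      ∃ z', F.map (cokernel.π g) ≫ z' = z := fun g z hz => by
    have hc := CokernelCofork.mapIsColimit _ (cokernelIsCokernel g) F
    exact ⟨hc.desc (CokernelCofork.ofπ z hz), hc.fac _ WalkingParallelPair.one⟩
  obtain ⟨K, hK, hmax⟩ := WellFounded.has_min (wellFounded_gt (α := Subobject A))
    {K | F.map K.arrow ≫ y = 0} ⟨⊥, by simp⟩
  obtain ⟨y', hy'⟩ := desc _ _ hK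
  refine ⟨_, cokernel.π K.arrow, y', hy', fun {Z} f hf => ?_⟩
  obtain ⟨y'', hy''⟩ := desc _ _ hf
  have hz : kernel.ι (cokernel.π K.arrow ≫ cokernel.π f) ≫
      cokernel.π K.arrow ≫ cokernel.π f = 0 := kernel.condition _
  let K' := Subobject.mk (kernel.ι (cokernel.π K.arrow ≫ cokernel.π f))
  have hle : K ≤ K' := Subobject.le_mk_of_comm (kernel.lift _ K.arrow (by simp)) (by simp)
  have hK' : K' ∈ {K : Subobject A | F.map K.arrow ≫ y = 0} := by
    have : F.map (kernel.ι (cokernel.π K.arrow ≫ cokernel.π f)) ≫ y = 0 := by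
      rw [← hy', ← hy'', ← F.map_comp_assoc, ← F.map_comp_assoc, Category.assoc, hz]; simp
    change F.map K'.arrow ≫ y = 0
    rw [← Subobject.underlyingIso_hom_comp_eq_mk, F.map_comp, Category.assoc, this, comp_zero]
  have heq : K = K' := by
    by_contra hne
    exact hmax K' hK' (lt_of_le_of_ne hle hne)
  have hker : kernel.ι (cokernel.π K.arrow ≫ cokernel.π f) ≫ cokernel.π K.arrow = 0 := by
    have h : kernel.ι (cokernel.π K.arrow ≫ cokernel.π f) =
        Subobject.ofMkLE _ K heq.ge ≫ K.arrow := by simp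
    rw [h, Category.assoc, cokernel.condition, comp_zero]
  have hmono : Mono (cokernel.π f) := by
    refine Preadditive.mono_of_cancel_zero _ fun {G} g hg => ?_
    have hp : pullback.fst (cokernel.π K.arrow) g ≫ cokernel.π K.arrow = 0 := by
      have h : pullback.fst (cokernel.π K.arrow) g =
          kernel.lift (cokernel.π K.arrow ≫ cokernel.π f) (pullback.fst _ g) (by
            rw [pullback.condition_assoc, hg, comp_zero]) ≫ kernel.ι _ := by simp
      rw [h, Category.assoc, hker, comp_zero]
    rw [pullback.condition] at hp
    exact (cancel_epi (pullback.snd (cokernel.π K.arrow) g)).1 (by rw [hp, comp_zero])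
  exact (cancel_mono (cokernel.π f)).1 (by simp)

/-- The functor `Hom(F -, X)` on a finite category is representable if `F` is right exact. The
representing object is the largest subfunctor of the form `Hom(-, U)`, the size being measured by
the dimension of `Hom(P, U)` for a projective object `P` which detects zero objects. -/
lemma exists_universal_element [Linear k C] [FiniteLinearCategory k B] (F : B ⥤ C)
    [F.Additive] [F.Linear k] [PreservesFiniteColimits F] (X : C)
    [∀ Y : C, FiniteDimensional k (Y ⟶ X)] :
    ∃ (U : B) (e : F.obj U ⟶ X), ∀ (A : B) (g : F.obj A ⟶ X), ∃! f : A ⟶ U, F.map f ≫ e = g := by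
  let _ := FiniteLinearCategory.abelian k B
  have hfd : ∀ M N : B, FiniteDimensional k (M ⟶ N) :=
    FiniteLinearCategory.finiteDimensional_hom
  obtain ⟨P, hP, hP'⟩ := exists_projective_detecting_zero k (B := B)
  let T : Set ℕ := {n | ∃ (U : B) (e : F.obj U ⟶ X),
    (∀ (Z : B) (f : Z ⟶ U), F.map f ≫ e = 0 → f = 0) ∧ Module.finrank k (P ⟶ U) = n}
  have hne : T.Nonempty := by
    obtain ⟨A', _, y', _, h⟩ := exists_minimal_element k F P (0 : F.obj P ⟶ X)
    exact ⟨_, A', y', fun Z f => h f, rfl⟩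
  have hbdd : BddAbove T := by
    refine ⟨Module.finrank k (F.obj P ⟶ X), ?_⟩
    rintro _ ⟨U, e, he, rfl⟩
    refine LinearMap.finrank_le_finrank_of_injective
      (f := Linear.rightComp k (F.obj P) e ∘ₗ F.mapLinearMap k) ?_
    rw [injective_iff_map_eq_zero]
    exact fun f hf => he P f hf
  -- the pair `(U, e)` with the largest dimension of `Hom(P, U)`
  obtain ⟨U, e, he, hU⟩ := Nat.sSup_mem hne hbdd
  refine ⟨U, e, fun A g => ?_⟩
  -- enlarge `U` to some `U'` with a morphism `A ⟶ U'`; by maximality, `U ⟶ U'` is invertible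
  obtain ⟨U', q, y', hq, hy'⟩ := exists_minimal_element k F (A ⊞ U)
    (F.map biprod.fst ≫ g + F.map biprod.snd ≫ e)
  have hi : F.map (biprod.inr ≫ q) ≫ y' = e := by
    rw [F.map_comp, Category.assoc, hq]
    simp [← F.map_comp_assoc]
  have hl : F.map (biprod.inl ≫ q) ≫ y' = g := by
    rw [F.map_comp, Category.assoc, hq]
    simp [← F.map_comp_assoc]
  have : Mono (biprod.inr ≫ q) := by
    refine Preadditive.mono_of_cancel_zero _ fun {Z} h hh => he Z h ?_
    rw [← hi, ← F.map_comp_assoc, hh]; simp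
  have hsurj : Function.Surjective (Linear.rightComp k P (biprod.inr ≫ q)) := by
    have hinj : Function.Injective (Linear.rightComp k P (biprod.inr ≫ q)) :=
      fun f f' h => (cancel_mono (biprod.inr ≫ q)).1 h
    refine (LinearMap.injective_iff_surjective_of_finrank_eq_finrank
      (le_antisymm (LinearMap.finrank_le_finrank_of_injective hinj) ?_)).1 hinj
    rw [hU]
    exact le_csSup hbdd ⟨U', y', fun Z f => hy' f, rfl⟩
  have hcok : IsZero (cokernel (biprod.inr ≫ q)) := hP' _ fun f => by
    obtain ⟨f', hf'⟩ := hsurj (Projective.factorThru f (cokernel.π (biprod.inr ≫ q)))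
    rw [← Projective.factorThru_comp f (cokernel.π (biprod.inr ≫ q)), ← hf',
      Linear.rightComp_apply, Category.assoc, cokernel.condition, comp_zero]
  have : Epi (biprod.inr ≫ q) := Preadditive.epi_of_isZero_cokernel _ hcok
  have : IsIso (biprod.inr ≫ q) := isIso_of_mono_of_epi _
  have hinv : F.map (inv (biprod.inr ≫ q)) ≫ e = y' := by
    rw [← hi, ← F.map_comp_assoc]
    simp
  refine ⟨(biprod.inl ≫ q) ≫ inv (biprod.inr ≫ q), ?_, fun f hf => ?_⟩
  · change F.map _ ≫ e = g
    rw [F.map_comp, Category.assoc, hinv, hl]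
  · have hf' : F.map f ≫ e = g := hf
    rw [← sub_eq_zero]
    apply he
    rw [F.map_sub, Preadditive.sub_comp, hf', F.map_comp, Category.assoc, hinv, hl, sub_self]

end Representability

/-! ### Mates under duality -/

section Mates

variable {C : Type u₁} [Category.{v₁} C] [MonoidalCategory C]

/-- The mate `Y ⟶ Z ⊗ X` of a morphism `Y ⊗ ᘁX ⟶ Z`. -/
abbrev mate {X Y Z : C} [HasLeftDual X] : (Y ⊗ (ᘁX : C) ⟶ Z) ≃ (Y ⟶ Z ⊗ X) :=
  tensorRightHomEquiv Y (ᘁX : C) X Z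

lemma mate_apply {X Y Z : C} [HasLeftDual X] (p : Y ⊗ (ᘁX : C) ⟶ Z) :
    mate p = (ρ_ Y).inv ≫ Y ◁ ExactPairing.coevaluation (ᘁX : C) X ≫
      (α_ Y (ᘁX : C) X).inv ≫ p ▷ X := rfl

lemma mate_comp {X Y Z Z' : C} [HasLeftDual X] (p : Y ⊗ (ᘁX : C) ⟶ Z) (g : Z ⟶ Z') :
    mate (p ≫ g) = mate p ≫ g ▷ X :=
  tensorRightHomEquiv_naturality p g

lemma mate_whiskerRight_comp {X Y Y' Z : C} [HasLeftDual X] (f : Y ⟶ Y')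
    (p : Y' ⊗ (ᘁX : C) ⟶ Z) : mate (f ▷ (ᘁX : C) ≫ p) = f ≫ mate p := by
  simp only [mate_apply, comp_whiskerRight, ← associator_inv_naturality_left_assoc,
    whisker_exchange_assoc, rightUnitor_inv_naturality_assoc]

lemma mate_adjointMate_comp {X X' Y Z : C} [HasLeftDual X] [HasLeftDual X'] (f : X ⟶ X')
    (p : Y ⊗ (ᘁX : C) ⟶ Z) : mate (Y ◁ leftAdjointMate f ≫ p) = mate p ≫ Z ◁ f := by
  simp only [mate_apply, comp_whiskerRight, ← associator_inv_naturality_middle_assoc,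
    Category.assoc]
  rw [← whiskerLeft_comp_assoc, coevaluation_comp_leftAdjointMate, whiskerLeft_comp_assoc,
    associator_inv_naturality_right_assoc, whisker_exchange]

lemma mate_evaluation (X : C) [HasLeftDual X] :
    mate (ExactPairing.evaluation (ᘁX : C) X) = (λ_ X).inv := by
  rw [mate_apply, ExactPairing.coevaluation_evaluation, Iso.inv_hom_id_assoc]

lemma coevaluation_dualTensorIso [LeftRigidCategory C] (X Y : C) :
    ExactPairing.coevaluation (ᘁ(X ⊗ Y) : C) (X ⊗ Y) ≫ (dualTensorIso X Y).inv ▷ (X ⊗ Y) =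
      (tensorPairing X Y).coevaluation' := by
  rw [← cancel_mono ((dualTensorIso X Y).hom ▷ (X ⊗ Y)), Category.assoc, ← comp_whiskerRight,
    Iso.inv_hom_id, id_whiskerRight, Category.comp_id]
  have := @coevaluation_comp_leftAdjointMate C _ _ (X ⊗ Y) (X ⊗ Y) inferInstance
    (hasLeftDualTensor) (𝟙 _)
  simp only [whiskerLeft_id, Category.comp_id] at this
  exact this.symm

/-- Mates under the dual of a tensor product are iterated mates. -/
lemma mate_dualTensorIso [LeftRigidCategory C] {M X Y Z : C}
    (p : (Y ⊗ (ᘁX : C)) ⊗ (ᘁM : C) ⟶ Z) :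
    mate (Y ◁ (dualTensorIso M X).inv ≫ (α_ Y (ᘁX : C) (ᘁM : C)).inv ≫ p) =
      mate (mate p) ≫ (α_ Z M X).hom := by
  calc
    _ = (ρ_ Y).inv ≫ Y ◁ (ExactPairing.coevaluation (ᘁ(M ⊗ X) : C) (M ⊗ X) ≫
          (dualTensorIso M X).inv ▷ (M ⊗ X)) ≫ (α_ Y _ (M ⊗ X)).inv ≫
          (α_ Y (ᘁX : C) (ᘁM : C)).inv ▷ (M ⊗ X) ≫ p ▷ (M ⊗ X) := by
        simp only [mate_apply, comp_whiskerRight, whiskerLeft_comp, Category.assoc,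
          associator_inv_naturality_middle_assoc]
    _ = (ρ_ Y).inv ≫ Y ◁ (ExactPairing.coevaluation (ᘁX : C) X ⊗≫
          ((ᘁX : C) ◁ ExactPairing.coevaluation (ᘁM : C) M) ▷ X ⊗≫ 𝟙 _) ≫
          (α_ Y _ (M ⊗ X)).inv ≫ (α_ Y (ᘁX : C) (ᘁM : C)).inv ▷ (M ⊗ X) ≫ p ▷ (M ⊗ X) := by
        rw [coevaluation_dualTensorIso]; rfl
    _ = _ := by
        rw [mate_apply, mate_apply]
        monoidal

end Mates

/-! ### Relative cowedges as module coactions -/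

section Coactions

open Functor.LaxRightLinear Functor.OplaxRightLinear Functor.RightLinear

variable {C : Type u₁} [Category.{v₁} C] [MonoidalCategory C]
  {B : Type u₂} [Category.{v₂} B] [MonoidalRightAction C B]

section Lineator

variable (F : B ⥤ C) [F.RightLinear C]

/-- The structure isomorphism `c_{A,X} : F(A ◁ X) ≅ F(A) ⊗ X` of a module functor with values
in `C`, with the action of `C` on itself spelled out as the tensor product. -/
def lineator (A : B) (X : C) : F.obj (A ⊙ᵣ X) ≅ F.obj A ⊗ X := (μᵣIso F A X).symm

lemma lineator_naturality_left {A A' : B} (f : A ⟶ A') (X : C) :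
    F.map (f ⊵ᵣ X) ≫ (lineator F A' X).hom = (lineator F A X).hom ≫ F.map f ▷ X :=
  δᵣ_naturality_left F f X

lemma lineator_naturality_right (A : B) {X X' : C} (f : X ⟶ X') :
    F.map (A ⊴ᵣ f) ≫ (lineator F A X').hom = (lineator F A X).hom ≫ F.obj A ◁ f :=
  δᵣ_naturality_right F A f

lemma lineator_associativity (A : B) (X Y : C) :
    F.map (αᵣ A X Y).hom ≫ (lineator F (A ⊙ᵣ X) Y).hom ≫ (lineator F A X).hom ▷ Y =
      (lineator F A (X ⊗ Y)).hom ≫ (α_ (F.obj A) X Y).inv :=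
  (δᵣ_associativity F A X Y).symm

lemma lineator_unitality (A : B) :
    F.map (ρᵣ[C] A).inv ≫ (lineator F A (𝟙_ C)).hom = (ρ_ (F.obj A)).inv :=
  (δᵣ_unitality_inv (C := C) F A).symm

end Lineator

/-- A natural transformation `a : F ⟶ Z ⊗ F(-)` of `C`-module functors. -/
structure IsModuleCoaction (F : B ⥤ C) [F.RightLinear C] (Z : C)
    (a : ∀ A : B, F.obj A ⟶ Z ⊗ F.obj A) : Prop where
  naturality {A A' : B} (f : A ⟶ A') : a A ≫ Z ◁ F.map f = F.map f ≫ a A'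
  linear (A : B) (X : C) : a (A ⊙ᵣ X) ≫ Z ◁ (lineator F A X).hom =
    (lineator F A X).hom ≫ a A ▷ X ≫ (α_ Z (F.obj A) X).hom

section LeftRigid

variable [LeftRigidCategory C]

/-- Mates turn the prebalancing into the coevaluation of `X`. -/
lemma mate_prebalancing (F : B ⥤ C) [F.RightLinear C] (X : C) (M N : B) {Z : C}
    (q : F.obj (N ⊙ᵣ (ᘁX : C)) ⊗ (ᘁ(F.obj M) : C) ⟶ Z) :
    mate ((coendPrebalancingIso F X M N).hom ≫ q) =
      (ρ_ _).inv ≫ F.obj N ◁ ExactPairing.coevaluation (ᘁX : C) X ≫ (α_ _ _ _).inv ≫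
        (lineator F N (ᘁX : C)).inv ▷ X ≫ mate q ▷ X ≫ (α_ Z (F.obj M) X).hom ≫
          Z ◁ (lineator F M X).inv := by
  have h : (coendPrebalancingIso F X M N).hom ≫ q =
      F.obj N ◁ leftAdjointMate (lineator F M X).inv ≫
        (F.obj N ◁ (dualTensorIso (F.obj M) X).inv ≫ (α_ _ _ _).inv ≫
          (lineator F N (ᘁX : C)).inv ▷ _ ≫ q) := by
    rw [coendPrebalancingIso_hom, dualActionIso, Iso.trans_hom, whiskerLeft_comp]
    simp only [Category.assoc]
    rfl
  rw [h, mate_adjointMate_comp, mate_dualTensorIso, mate_whiskerRight_comp, mate_apply]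
  simp

lemma mate_associator_whiskerLeft {X Y Z W : C} (q : Y ⊗ (ᘁX : C) ⟶ W) :
    mate ((α_ Z Y (ᘁX : C)).hom ≫ Z ◁ q) = Z ◁ mate q ≫ (α_ Z W X).inv := by
  simp only [mate_apply]
  monoidal

lemma map_coevaluation_lineator (F : B ⥤ C) [F.RightLinear C] (N : B) (X : C) :
    F.map (ρᵣ[C] N).inv ≫ F.map (N ⊴ᵣ ExactPairing.coevaluation (ᘁX : C) X) ≫
        F.map (αᵣ N (ᘁX : C) X).hom ≫ (lineator F (N ⊙ᵣ (ᘁX : C)) X).hom =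
      mate (lineator F N (ᘁX : C)).inv := by
  rw [← cancel_mono ((lineator F N (ᘁX : C)).hom ▷ X)]
  simp only [Category.assoc, lineator_associativity, reassoc_of% lineator_naturality_right,
    reassoc_of% lineator_unitality, mate_apply, ← comp_whiskerRight, Iso.inv_hom_id,
    id_whiskerRight, Category.comp_id]

/-- The compatibility of a family of legs with the prebalancing, for the objects `N` and `X`,
says that its mates commute with the lineators for the objects `N` and `ᘁX`. -/
lemma balanced_iff_linear (F : B ⥤ C) [F.RightLinear C] {Z : C}
    (p : ∀ A : B, F.obj A ⊗ (ᘁ(F.obj A) : C) ⟶ Z) (N : B) (X : C) :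
    F.obj N ◁ leftAdjointMate (F.map (N ⊴ᵣ ExactPairing.coevaluation (ᘁX : C) X)) ≫
        F.obj N ◁ leftAdjointMate (F.map (ρᵣ[C] N).inv) ≫ p N =
      F.obj N ◁ leftAdjointMate (F.map (αᵣ N (ᘁX : C) X).inv) ≫
        (coendPrebalancingIso F X (N ⊙ᵣ (ᘁX : C)) N).hom ≫ p (N ⊙ᵣ (ᘁX : C)) ↔
    mate (p (N ⊙ᵣ (ᘁX : C))) ≫ Z ◁ (lineator F N (ᘁX : C)).hom =
      (lineator F N (ᘁX : C)).hom ≫ mate (p N) ▷ (ᘁX : C) ≫ (α_ Z (F.obj N) (ᘁX : C)).hom := by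
  let φ : F.obj (N ⊙ᵣ ((ᘁX : C) ⊗ X)) ≅ F.obj (N ⊙ᵣ (ᘁX : C)) ⊗ X :=
    F.mapIso (αᵣ N (ᘁX : C) X) ≪≫ lineator F (N ⊙ᵣ (ᘁX : C)) X
  have h₁ : mate (F.obj N ◁ leftAdjointMate
        (F.map (N ⊴ᵣ ExactPairing.coevaluation (ᘁX : C) X)) ≫
        F.obj N ◁ leftAdjointMate (F.map (ρᵣ[C] N).inv) ≫ p N) ≫ Z ◁ φ.hom =
      mate (p N) ≫ Z ◁ mate (lineator F N (ᘁX : C)).inv := by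
    change _ ≫ Z ◁ (F.map _ ≫ _) = _
    rw [mate_adjointMate_comp, mate_adjointMate_comp, ← map_coevaluation_lineator]
    simp only [whiskerLeft_comp, Category.assoc]
  have h₂ : mate (F.obj N ◁ leftAdjointMate (F.map (αᵣ N (ᘁX : C) X).inv) ≫
        (coendPrebalancingIso F X (N ⊙ᵣ (ᘁX : C)) N).hom ≫ p (N ⊙ᵣ (ᘁX : C))) ≫ Z ◁ φ.hom =
      mate ((lineator F N (ᘁX : C)).inv ≫ mate (p (N ⊙ᵣ (ᘁX : C)))) ≫ (α_ _ _ _).hom := by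
    have h : F.map (αᵣ N (ᘁX : C) X).inv ≫ φ.hom = (lineator F (N ⊙ᵣ (ᘁX : C)) X).hom := by
      simp [φ, ← F.map_comp_assoc]
    rw [mate_adjointMate_comp, mate_prebalancing, mate_comp, mate_apply (lineator F N (ᘁX : C)).inv]
    simp only [Category.assoc, ← whiskerLeft_comp, h, Iso.inv_hom_id, whiskerLeft_id,
      Category.comp_id]
  rw [← mate.injective.eq_iff, ← cancel_mono (Z ◁ φ.hom), h₁, h₂, ← Iso.comp_inv_eq,
    Category.assoc, ← mate_associator_whiskerLeft, ← mate_whiskerRight_comp,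
    mate.injective.eq_iff, ← whiskerLeftIso_hom, ← whiskerLeftIso_inv, ← Iso.eq_comp_inv,
    Category.assoc, Category.assoc, Iso.eq_inv_comp, eq_comm]

/-- A transformation of module functors `F ⟶ Z ⊗ F(-)` gives a relative cowedge. -/
def cowedgeOfCoaction {F : B ⥤ C} [F.RightLinear C] {Z : C} {a : ∀ A : B, F.obj A ⟶ Z ⊗ F.obj A}
    (h : IsModuleCoaction F Z a) : RelativeCowedge (coendFunctor F) (coendPrebalancing F) where
  pt := Z
  π N := mate.symm (a N)
  dinatural {M N} f := by
    apply mate.injective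
    refine ((mate_adjointMate_comp _ _).trans ?_).trans (mate_whiskerRight_comp _ _).symm
    simpa using h.naturality f
  balanced N X := by
    refine (balanced_iff_linear F (fun N => mate.symm (a N)) N X).2 ?_
    simpa using h.linear N (ᘁX : C)

lemma coendCoaction_cowedgeOfCoaction {F : B ⥤ C} [F.RightLinear C] {Z : C}
    {a : ∀ A : B, F.obj A ⟶ Z ⊗ F.obj A} (h : IsModuleCoaction F Z a) (A : B) :
    coendCoaction (cowedgeOfCoaction h) A = a A :=
  mate.apply_symm_apply (a A)

end LeftRigid

/-- The mates of the legs of a relative cowedge form a transformation of module functors. -/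
lemma RelativeCowedge.isModuleCoaction [RigidCategory C] {F : B ⥤ C} [F.RightLinear C]
    (K : RelativeCowedge (coendFunctor F) (coendPrebalancing F)) :
    IsModuleCoaction F K.pt (coendCoaction K) where
  naturality {M N} f := by
    have h := congrArg mate (K.dinatural f)
    exact ((mate_adjointMate_comp _ _).symm.trans h).trans (mate_whiskerRight_comp _ _)
  linear N Y := by
    -- every object is a left dual, up to isomorphism
    obtain ⟨X, ⟨e⟩⟩ : ∃ X : C, Nonempty ((ᘁX : C) ≅ Y) :=
      ⟨Yᘁ, ⟨leftDualIso (LeftRigidCategory.leftDual (Yᘁ)).exact HasRightDual.exact⟩⟩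
    have h : coendCoaction K (N ⊙ᵣ (ᘁX : C)) ≫ K.pt ◁ (lineator F N (ᘁX : C)).hom =
        (lineator F N (ᘁX : C)).hom ≫ coendCoaction K N ▷ (ᘁX : C) ≫ (α_ _ _ _).hom :=
      (balanced_iff_linear F (leg K) N X).1 (K.balanced N X)
    have hnat : coendCoaction K (N ⊙ᵣ (ᘁX : C)) ≫ K.pt ◁ F.map (N ⊴ᵣ e.hom) =
        F.map (N ⊴ᵣ e.hom) ≫ coendCoaction K (N ⊙ᵣ Y) := by
      have h := congrArg mate (K.dinatural (N ⊴ᵣ e.hom))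
      exact ((mate_adjointMate_comp _ _).symm.trans h).trans (mate_whiskerRight_comp _ _)
    have : IsIso (F.map (N ⊴ᵣ e.hom)) := inferInstance
    rw [← cancel_epi (F.map (N ⊴ᵣ e.hom)), ← reassoc_of% hnat, ← whiskerLeft_comp,
      lineator_naturality_right, whiskerLeft_comp, reassoc_of% h,
      reassoc_of% lineator_naturality_right, whisker_exchange_assoc, associator_naturality_right]

end Coactions

/-! ### The right adjoint of a module functor -/

section RightAdjoint

open MonoidalRightAction

variable {C : Type u₁} [Category.{v₁} C] [MonoidalCategory C]
  {B : Type u₂} [Category.{v₂} B] [MonoidalRightAction C B]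

/-- The zigzag identity of a dual pair, acting on an object of a module category. -/
lemma action_zigzag [LeftRigidCategory C] (U : B) (X : C) :
    (ρᵣ[C] (U ⊙ᵣ X)).inv ≫ (U ⊙ᵣ X) ⊴ᵣ ExactPairing.coevaluation (ᘁX : C) X ≫
      (αᵣ (U ⊙ᵣ X) (ᘁX : C) X).hom ≫
      ((αᵣ U X (ᘁX : C)).inv ≫ U ⊴ᵣ ExactPairing.evaluation (ᘁX : C) X ≫ (ρᵣ[C] U).hom) ⊵ᵣ X =
      𝟙 (U ⊙ᵣ X) := by
  have h₁ : (ρᵣ[C] (U ⊙ᵣ X)).inv = U ⊴ᵣ (ρ_ X).inv ≫ (αᵣ U X (𝟙_ C)).hom := by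
    rw [← cancel_epi (U ⊴ᵣ (ρ_ X).hom), actionHomRight_hom_inv_assoc, actionHom_rightUnitor,
      Category.assoc, Iso.hom_inv_id, Category.comp_id]
  have h₂ : (αᵣ U X ((ᘁX : C) ⊗ X)).hom ≫ (αᵣ (U ⊙ᵣ X) (ᘁX : C) X).hom ≫
      (αᵣ U X (ᘁX : C)).inv ⊵ᵣ X = U ⊴ᵣ (α_ X (ᘁX : C) X).inv ≫ (αᵣ U (X ⊗ (ᘁX : C)) X).hom := by
    rw [← cancel_epi (U ⊴ᵣ (α_ X (ᘁX : C) X).hom), actionHom_associator_assoc,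
      hom_inv_actionHomLeft, actionHomRight_hom_inv_assoc, Category.comp_id]
  have h₃ : (αᵣ U (X ⊗ (ᘁX : C)) X).hom ≫ (U ⊴ᵣ ExactPairing.evaluation (ᘁX : C) X) ⊵ᵣ X ≫
      (ρᵣ[C] U).hom ⊵ᵣ X =
      U ⊴ᵣ (ExactPairing.evaluation (ᘁX : C) X ▷ X) ≫ U ⊴ᵣ (λ_ X).hom := by
    simp
  rw [h₁, comp_actionHomLeft, comp_actionHomLeft, action_actionHomRight]
  simp only [Category.assoc, Iso.hom_inv_id_assoc, reassoc_of% h₂, h₃, ← actionHomRight_comp]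
  rw [ExactPairing.coevaluation_evaluation_assoc]
  simp

variable (F : B ⥤ C) [F.RightLinear C]

/-- The morphism `F(U ◁ X) ≅ F(U) ⊗ X ⟶ X` induced by `e : F(U) ⟶ 𝟙`. -/
def inducedCounit {U : B} (e : F.obj U ⟶ 𝟙_ C) (X : C) : F.obj (U ⊙ᵣ X) ⟶ X :=
  (lineator F U X).hom ≫ e ▷ X ≫ (λ_ X).hom

lemma inducedCounit_naturality {U : B} (e : F.obj U ⟶ 𝟙_ C) {X Y : C} (f : X ⟶ Y) :
    F.map (U ⊴ᵣ f) ≫ inducedCounit F e Y = inducedCounit F e X ≫ f := by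
  simp only [inducedCounit, reassoc_of% lineator_naturality_right, whisker_exchange_assoc,
    Category.assoc, leftUnitor_naturality]

lemma map_evaluation_inducedCounit [LeftRigidCategory C] {U : B} (e : F.obj U ⟶ 𝟙_ C) (X : C) :
    F.map ((αᵣ U X (ᘁX : C)).inv ≫ U ⊴ᵣ ExactPairing.evaluation (ᘁX : C) X ≫ (ρᵣ[C] U).hom) ≫ e =
      (lineator F (U ⊙ᵣ X) (ᘁX : C)).hom ≫ inducedCounit F e X ▷ (ᘁX : C) ≫
        ExactPairing.evaluation (ᘁX : C) X := by
  have hρ : F.map (ρᵣ[C] U).hom = (lineator F U (𝟙_ C)).hom ≫ (ρ_ (F.obj U)).hom := by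
    rw [← cancel_epi (F.map (ρᵣ[C] U).inv), reassoc_of% lineator_unitality, ← F.map_comp]
    simp
  rw [← cancel_epi (F.map (αᵣ U X (ᘁX : C)).hom)]
  simp only [inducedCounit, F.map_comp, Category.assoc, comp_whiskerRight,
    reassoc_of% lineator_associativity, hρ, reassoc_of% lineator_naturality_right]
  rw [← F.map_comp_assoc, Iso.hom_inv_id, F.map_id, Category.id_comp,
    ← rightUnitor_naturality, whisker_exchange_assoc]
  monoidal

/-- If `e : F(U) ⟶ 𝟙` is universal among the morphisms from values of `F` to the unit object,
then `F(U ◁ X) ⟶ X` is universal among the morphisms from values of `F` to `X`. -/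
lemma inducedCounit_universal [LeftRigidCategory C] {U : B} {e : F.obj U ⟶ 𝟙_ C}
    (he : ∀ (A : B) (g : F.obj A ⟶ 𝟙_ C), ∃! f : A ⟶ U, F.map f ≫ e = g)
    (A : B) (X : C) (g : F.obj A ⟶ X) :
    ∃! f : A ⟶ U ⊙ᵣ X, F.map f ≫ inducedCounit F e X = g := by
  apply existsUnique_of_exists_of_unique
  · obtain ⟨f, hf, -⟩ := he (A ⊙ᵣ (ᘁX : C))
      ((lineator F A (ᘁX : C)).hom ≫ mate.symm (g ≫ (λ_ X).inv))
    refine ⟨(ρᵣ[C] A).inv ≫ A ⊴ᵣ ExactPairing.coevaluation (ᘁX : C) X ≫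
      (αᵣ A (ᘁX : C) X).hom ≫ f ⊵ᵣ X, ?_⟩
    simp only [F.map_comp, Category.assoc, inducedCounit, reassoc_of% lineator_naturality_left,
      ← comp_whiskerRight_assoc, hf]
    have h := map_coevaluation_lineator F A X
    simp only [← Category.assoc] at h ⊢
    rw [h, ← mate_comp, Iso.inv_hom_id_assoc, Equiv.apply_symm_apply]
    simp
  · -- both solutions are recovered from a morphism `A ◁ ᘁX ⟶ U`
    have key : ∀ f : A ⟶ U ⊙ᵣ X, F.map f ≫ inducedCounit F e X = g →
        F.map (f ⊵ᵣ (ᘁX : C) ≫ (αᵣ U X (ᘁX : C)).inv ≫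
          U ⊴ᵣ ExactPairing.evaluation (ᘁX : C) X ≫ (ρᵣ[C] U).hom) ≫ e =
        (lineator F A (ᘁX : C)).hom ≫ g ▷ (ᘁX : C) ≫
          ExactPairing.evaluation (ᘁX : C) X := by
      intro f hf
      rw [F.map_comp, Category.assoc, map_evaluation_inducedCounit,
        reassoc_of% lineator_naturality_left, ← comp_whiskerRight_assoc, hf]
    intro f f' hf hf'
    have h := (he _ _).unique (key f hf) (key f' hf')
    have recover : ∀ f : A ⟶ U ⊙ᵣ X, f = (ρᵣ[C] A).inv ≫
        A ⊴ᵣ ExactPairing.coevaluation (ᘁX : C) X ≫ (αᵣ A (ᘁX : C) X).hom ≫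
        (f ⊵ᵣ (ᘁX : C) ≫ (αᵣ U X (ᘁX : C)).inv ≫
          U ⊴ᵣ ExactPairing.evaluation (ᘁX : C) X ≫ (ρᵣ[C] U).hom) ⊵ᵣ X := by
      intro f
      have hα : (αᵣ A (ᘁX : C) X).hom ≫ (f ⊵ᵣ (ᘁX : C)) ⊵ᵣ X =
          f ⊵ᵣ ((ᘁX : C) ⊗ X) ≫ (αᵣ (U ⊙ᵣ X) (ᘁX : C) X).hom := by simp
      rw [comp_actionHomLeft, reassoc_of% hα, action_exchange_assoc,
        actionUnitIso_inv_naturality_assoc, action_zigzag, Category.comp_id]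
    rw [recover f, recover f', h]

end RightAdjoint

/-! ### The universal coaction and the relative coend -/

section UniversalCoaction

open MonoidalRightAction

variable {C : Type u₁} [Category.{v₁} C] [MonoidalCategory C]
  {B : Type u₂} [Category.{v₂} B] [MonoidalRightAction C B]
  {F : B ⥤ C} [F.RightLinear C]

lemma IsModuleCoaction.comp {Z W : C} {a : ∀ A : B, F.obj A ⟶ Z ⊗ F.obj A}
    (h : IsModuleCoaction F Z a) (g : Z ⟶ W) :
    IsModuleCoaction F W (fun A => a A ≫ g ▷ F.obj A) where
  naturality f := by
    rw [Category.assoc, ← whisker_exchange, reassoc_of% (h.naturality)]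
  linear A X := by
    rw [Category.assoc, ← whisker_exchange, reassoc_of% (h.linear)]
    simp

lemma isModuleCoaction_leftUnitor_inv :
    IsModuleCoaction F (𝟙_ C) (fun A => (λ_ (F.obj A)).inv) where
  naturality f := (leftUnitor_inv_naturality _).symm
  linear A X := by
    rw [← leftUnitor_inv_naturality, leftUnitor_tensor_inv]

lemma IsModuleCoaction.tensor {Z W : C} {a : ∀ A : B, F.obj A ⟶ Z ⊗ F.obj A}
    {b : ∀ A : B, F.obj A ⟶ W ⊗ F.obj A}
    (ha : IsModuleCoaction F Z a) (hb : IsModuleCoaction F W b) :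
    IsModuleCoaction F (Z ⊗ W) (fun A => a A ≫ Z ◁ b A ≫ (α_ Z W (F.obj A)).inv) where
  naturality f := by
    rw [Category.assoc, Category.assoc, ← associator_inv_naturality_right,
      ← whiskerLeft_comp_assoc, hb.naturality, whiskerLeft_comp_assoc, reassoc_of% (ha.naturality)]
  linear A X := by
    rw [Category.assoc, Category.assoc, ← associator_inv_naturality_right,
      ← whiskerLeft_comp_assoc, hb.linear, whiskerLeft_comp_assoc, reassoc_of% (ha.linear)]
    simp

section Adjunction

variable [LeftRigidCategory C]

variable {U : B} {e : F.obj U ⟶ 𝟙_ C}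
    (he : ∀ (A : B) (g : F.obj A ⟶ 𝟙_ C), ∃! f : A ⟶ U, F.map f ≫ e = g)

/-- The unit `A ⟶ U ◁ F(A)` of the adjunction between `F` and `X ↦ U ◁ X`. -/
noncomputable def moduleUnit (A : B) : A ⟶ U ⊙ᵣ F.obj A :=
  (inducedCounit_universal F he A (F.obj A) (𝟙 _)).exists.choose

lemma moduleUnit_counit (A : B) :
    F.map (moduleUnit he A) ≫ inducedCounit F e (F.obj A) = 𝟙 (F.obj A) :=
  (inducedCounit_universal F he A (F.obj A) (𝟙 _)).exists.choose_spec

lemma moduleUnit_inducedCounit (X : C) :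
    moduleUnit he (U ⊙ᵣ X) ≫ U ⊴ᵣ inducedCounit F e X = 𝟙 (U ⊙ᵣ X) := by
  refine (inducedCounit_universal F he _ _ (inducedCounit F e X)).unique ?_ (by simp)
  rw [F.map_comp, Category.assoc, inducedCounit_naturality, reassoc_of% moduleUnit_counit]

lemma moduleUnit_naturality {A A' : B} (f : A ⟶ A') :
    moduleUnit he A ≫ U ⊴ᵣ F.map f = f ≫ moduleUnit he A' := by
  refine (inducedCounit_universal F he _ _ (F.map f)).unique ?_ ?_
  · rw [F.map_comp, Category.assoc, inducedCounit_naturality, reassoc_of% moduleUnit_counit]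
  · rw [F.map_comp, Category.assoc, moduleUnit_counit, Category.comp_id]

lemma moduleUnit_linear (A : B) (X : C) :
    moduleUnit he (A ⊙ᵣ X) ≫ U ⊴ᵣ (lineator F A X).hom =
      moduleUnit he A ⊵ᵣ X ≫ (αᵣ U (F.obj A) X).inv := by
  refine (inducedCounit_universal F he _ _ (lineator F A X).hom).unique ?_ ?_
  · rw [F.map_comp, Category.assoc, inducedCounit_naturality, reassoc_of% moduleUnit_counit]
  · have h : F.map (αᵣ U (F.obj A) X).inv ≫ inducedCounit F e (F.obj A ⊗ X) =
        (lineator F (U ⊙ᵣ F.obj A) X).hom ≫ inducedCounit F e (F.obj A) ▷ X := by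
      rw [← cancel_epi (F.map (αᵣ U (F.obj A) X).hom), ← F.map_comp_assoc, Iso.hom_inv_id,
        F.map_id, Category.id_comp]
      simp only [inducedCounit, comp_whiskerRight, reassoc_of% lineator_associativity]
      monoidal
    rw [F.map_comp, Category.assoc, h, reassoc_of% lineator_naturality_left, ← comp_whiskerRight,
      moduleUnit_counit, id_whiskerRight, Category.comp_id]

/-- The universal coaction `F(A) ⟶ F(U ◁ F(A)) ≅ F(U) ⊗ F(A)`. -/
noncomputable def universalCoaction (A : B) : F.obj A ⟶ F.obj U ⊗ F.obj A :=
  F.map (moduleUnit he A) ≫ (lineator F U (F.obj A)).hom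

lemma isModuleCoaction_universalCoaction :
    IsModuleCoaction F (F.obj U) (universalCoaction he) where
  naturality f := by
    rw [universalCoaction, Category.assoc, ← lineator_naturality_right, ← F.map_comp_assoc,
      moduleUnit_naturality, F.map_comp_assoc, universalCoaction]
  linear A X := by
    rw [universalCoaction, Category.assoc, ← lineator_naturality_right, ← F.map_comp_assoc,
      moduleUnit_linear, F.map_comp_assoc, universalCoaction, comp_whiskerRight, Category.assoc,
      ← reassoc_of% lineator_naturality_left, ← cancel_mono (α_ (F.obj U) (F.obj A) X).inv]
    simp only [Category.assoc, Iso.hom_inv_id, Category.comp_id]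
    rw [← lineator_associativity, ← F.map_comp_assoc (αᵣ U (F.obj A) X).inv, Iso.inv_hom_id,
      F.map_id, Category.id_comp]

/-- The natural transformation `F(U ◁ X) ⟶ Z ⊗ X` which corresponds under the adjunction to the
transformation `a : F ⟶ Z ⊗ F(-)`. -/
def coactionMate {Z : C} (a : ∀ A : B, F.obj A ⟶ Z ⊗ F.obj A) {U : B} (e : F.obj U ⟶ 𝟙_ C)
    (X : C) : F.obj (U ⊙ᵣ X) ⟶ Z ⊗ X :=
  a (U ⊙ᵣ X) ≫ Z ◁ inducedCounit F e X

lemma coactionMate_universalCoaction (X : C) :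
    coactionMate (universalCoaction he) e X = (lineator F U X).hom := by
  rw [coactionMate, universalCoaction, Category.assoc, ← lineator_naturality_right,
    ← F.map_comp_assoc, moduleUnit_inducedCounit, F.map_id, Category.id_comp]

lemma existsUnique_universalCoaction_comp {Z : C} {a : ∀ A : B, F.obj A ⟶ Z ⊗ F.obj A}
    (h : IsModuleCoaction F Z a) :
    ∃! g : F.obj U ⟶ Z, ∀ A : B, universalCoaction he A ≫ g ▷ F.obj A = a A := by
  refine ⟨a U ≫ Z ◁ e ≫ (ρ_ Z).hom, fun A => ?_, fun g hg => ?_⟩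
  · have h₁ : (lineator F U (F.obj A)).hom ≫ (a U ≫ Z ◁ e ≫ (ρ_ Z).hom) ▷ F.obj A =
        a (U ⊙ᵣ F.obj A) ≫ Z ◁ inducedCounit F e (F.obj A) := by
      rw [inducedCounit, whiskerLeft_comp, reassoc_of% (h.linear)]
      monoidal
    rw [universalCoaction, Category.assoc, h₁, ← reassoc_of% (h.naturality), ← whiskerLeft_comp,
      moduleUnit_counit, whiskerLeft_id, Category.comp_id]
  · change ∀ A : B, universalCoaction he A ≫ g ▷ F.obj A = a A at hg
    have h₁ : universalCoaction he U ≫ F.obj U ◁ e ≫ (ρ_ _).hom = 𝟙 _ := by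
      have h₂ : F.map (ρᵣ[C] U).inv ≫ coactionMate (universalCoaction he) e (𝟙_ C) =
          universalCoaction he U ≫ F.obj U ◁ e := by
        have h₃ : F.map (ρᵣ[C] U).inv ≫ inducedCounit F e (𝟙_ C) = e := by
          rw [inducedCounit, reassoc_of% lineator_unitality, unitors_equal, rightUnitor_naturality,
            Iso.inv_hom_id_assoc]
        rw [coactionMate, ← reassoc_of% ((isModuleCoaction_universalCoaction he).naturality),
          ← whiskerLeft_comp, h₃]
      rw [← reassoc_of% h₂, coactionMate_universalCoaction, reassoc_of% lineator_unitality,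
        Iso.inv_hom_id]
    rw [← hg U, Category.assoc, ← whisker_exchange_assoc, rightUnitor_naturality,
      reassoc_of% h₁]

end Adjunction

section Coend

variable [LeftRigidCategory C]

lemma RelativeCowedge.leg_comp_eq_iff (K : RelativeCowedge (coendFunctor F) (coendPrebalancing F))
    {Z : C} (g : K.pt ⟶ Z) (p : ∀ A, F.obj A ⊗ (ᘁ(F.obj A) : C) ⟶ Z) :
    (∀ A, leg K A ≫ g = p A) ↔ ∀ A, coendCoaction K A ≫ g ▷ F.obj A = mate (p A) := by
  refine forall_congr' fun A => ?_
  rw [← mate.injective.eq_iff, mate_comp]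
  rfl

lemma RelativeCowedge.IsCoend.existsUnique_comp
    {K : RelativeCowedge (coendFunctor F) (coendPrebalancing F)} (hK : K.IsCoend)
    {Z : C} {a : ∀ A : B, F.obj A ⟶ Z ⊗ F.obj A} (h : IsModuleCoaction F Z a) :
    ∃! g : K.pt ⟶ Z, ∀ A : B, coendCoaction K A ≫ g ▷ F.obj A = a A := by
  have := hK (cowedgeOfCoaction h)
  refine (existsUnique_congr fun g => ?_).1 this
  refine (K.leg_comp_eq_iff g (fun A => mate.symm (a A))).trans ?_
  simp

end Coend

section CoendRigid

variable {C : Type u₁} [Category.{v₁} C] [MonoidalCategory C] [RigidCategory C]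
  {B : Type u₂} [Category.{v₂} B] [MonoidalRightAction C B]
  {F : B ⥤ C} [F.RightLinear C]

/-- A relative cowedge is a relative coend if its coaction is universal. -/
lemma RelativeCowedge.isCoend_of_existsUnique
    {K : RelativeCowedge (coendFunctor F) (coendPrebalancing F)}
    (h : ∀ {Z : C} {a : ∀ A : B, F.obj A ⟶ Z ⊗ F.obj A}, IsModuleCoaction F Z a →
      ∃! g : K.pt ⟶ Z, ∀ A : B, coendCoaction K A ≫ g ▷ F.obj A = a A) : K.IsCoend := by
  intro L
  exact (existsUnique_congr fun g => (K.leg_comp_eq_iff g (leg L)).symm).1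
    (h L.isModuleCoaction)

lemma exists_isCoend {U : B} {e : F.obj U ⟶ 𝟙_ C}
    (he : ∀ (A : B) (g : F.obj A ⟶ 𝟙_ C), ∃! f : A ⟶ U, F.map f ≫ e = g) :
    ∃ K : RelativeCowedge (coendFunctor F) (coendPrebalancing F), K.IsCoend := by
  refine ⟨cowedgeOfCoaction (isModuleCoaction_universalCoaction he),
    RelativeCowedge.isCoend_of_existsUnique fun {Z a} h => ?_⟩
  simp only [coendCoaction_cowedgeOfCoaction]
  exact existsUnique_universalCoaction_comp he h

/-- For a relative coend, the transformation `F(U ◁ X) ⟶ C(F) ⊗ X` is an isomorphism. -/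
lemma RelativeCowedge.IsCoend.isIso_coactionMate
    {K : RelativeCowedge (coendFunctor F) (coendPrebalancing F)} (hK : K.IsCoend)
    {U : B} {e : F.obj U ⟶ 𝟙_ C}
    (he : ∀ (A : B) (g : F.obj A ⟶ 𝟙_ C), ∃! f : A ⟶ U, F.map f ≫ e = g) (X : C) :
    IsIso (coactionMate (coendCoaction K) e X) := by
  obtain ⟨g, hg, -⟩ := existsUnique_universalCoaction_comp he K.isModuleCoaction
  obtain ⟨g', hg', -⟩ := hK.existsUnique_comp (isModuleCoaction_universalCoaction he)
  have h₁ : g ≫ g' = 𝟙 _ := by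
    refine (existsUnique_universalCoaction_comp he
      (isModuleCoaction_universalCoaction he)).unique (fun A => ?_) (fun A => by simp)
    rw [comp_whiskerRight, reassoc_of% (hg A), hg' A]
  have h₂ : g' ≫ g = 𝟙 _ := by
    refine (hK.existsUnique_comp K.isModuleCoaction).unique (fun A => ?_) (fun A => by simp)
    rw [comp_whiskerRight, reassoc_of% (hg' A), hg A]
  have : IsIso g := ⟨g', h₁, h₂⟩
  have h : coactionMate (coendCoaction K) e X = (lineator F U X).hom ≫ g ▷ X := by
    rw [coactionMate, ← hg, Category.assoc, ← whisker_exchange, ← Category.assoc,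
      ← coactionMate_universalCoaction he X]
    rfl
  rw [h]
  infer_instance

end CoendRigid

end UniversalCoaction

/-! ### The coalgebra structure of the relative coend -/

section Coalgebra

variable {C : Type u₁} [Category.{v₁} C] [MonoidalCategory C]
  {B : Type u₂} [Category.{v₂} B] [MonoidalRightAction C B]
  {F : B ⥤ C} [F.RightLinear C]

/-- The defining equations of the coalgebra structure say that the coactions `ρ_A` are
counital and coassociative. -/
lemma isCoendCoalgebra_iff [LeftRigidCategory C]
    (K : RelativeCowedge (coendFunctor F) (coendPrebalancing F)) (H : ComonObj K.pt) :
    IsCoendCoalgebra K H ↔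
      (∀ A, coendCoaction K A ≫ H.counit ▷ F.obj A = (λ_ (F.obj A)).inv) ∧
      ∀ A, coendCoaction K A ≫ H.comul ▷ F.obj A =
        coendCoaction K A ≫ K.pt ◁ coendCoaction K A ≫ (α_ _ _ _).inv := by
  have h₁ := K.leg_comp_eq_iff H.counit
    (fun A => ExactPairing.evaluation (ᘁ(F.obj A) : C) (F.obj A))
  have h₂ := K.leg_comp_eq_iff H.comul (fun A =>
      F.obj A ◁ ((λ_ _).inv ≫
          ExactPairing.coevaluation (ᘁ(F.obj A) : C) (F.obj A) ▷ (ᘁ(F.obj A) : C) ≫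
          (α_ _ _ _).hom) ≫
        (α_ (F.obj A) (ᘁ(F.obj A) : C) (F.obj A ⊗ (ᘁ(F.obj A) : C))).inv ≫
        (leg K A ⊗ₘ leg K A))
  have h₃ : ∀ A, mate (F.obj A ◁ ((λ_ _).inv ≫
          ExactPairing.coevaluation (ᘁ(F.obj A) : C) (F.obj A) ▷ (ᘁ(F.obj A) : C) ≫
          (α_ _ _ _).hom) ≫
        (α_ (F.obj A) (ᘁ(F.obj A) : C) (F.obj A ⊗ (ᘁ(F.obj A) : C))).inv ≫
        (leg K A ⊗ₘ leg K A)) =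
      coendCoaction K A ≫ K.pt ◁ coendCoaction K A ≫ (α_ _ _ _).inv := by
    intro A
    have : F.obj A ◁ ((λ_ _).inv ≫
          ExactPairing.coevaluation (ᘁ(F.obj A) : C) (F.obj A) ▷ (ᘁ(F.obj A) : C) ≫
          (α_ _ _ _).hom) ≫
        (α_ (F.obj A) (ᘁ(F.obj A) : C) (F.obj A ⊗ (ᘁ(F.obj A) : C))).inv ≫
        (leg K A ⊗ₘ leg K A) =
        coendCoaction K A ▷ (ᘁ(F.obj A) : C) ≫ (α_ _ _ _).hom ≫ K.pt ◁ leg K A := by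
      rw [coendCoaction, MonoidalCategory.tensorHom_def]
      monoidal
    rw [this, mate_whiskerRight_comp, mate_associator_whiskerLeft]
    rfl
  simp only [mate_evaluation] at h₁
  simp only [h₃] at h₂
  exact ⟨fun h => ⟨h₁.1 h.counit, h₂.1 h.comul⟩, fun h => ⟨h₁.2 h.1, h₂.2 h.2⟩⟩

variable [RigidCategory C] {K : RelativeCowedge (coendFunctor F) (coendPrebalancing F)}

lemma RelativeCowedge.IsCoend.hom_ext (hK : K.IsCoend) {Z : C} {g g' : K.pt ⟶ Z}
    (h : ∀ A, coendCoaction K A ≫ g ▷ F.obj A = coendCoaction K A ≫ g' ▷ F.obj A) : g = g' :=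
  (hK.existsUnique_comp (K.isModuleCoaction.comp g')).unique h fun _ => rfl

lemma RelativeCowedge.IsCoend.exists_comonObj (hK : K.IsCoend) :
    ∃ H : ComonObj K.pt, IsCoendCoalgebra K H := by
  obtain ⟨Δ, hΔ, -⟩ := hK.existsUnique_comp (K.isModuleCoaction.tensor K.isModuleCoaction)
  obtain ⟨ε, hε, -⟩ := hK.existsUnique_comp (isModuleCoaction_leftUnitor_inv (F := F))
  refine ⟨⟨ε, Δ, ?_, ?_, ?_⟩, (isCoendCoalgebra_iff K _).2 ⟨hε, hΔ⟩⟩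
  · refine hK.hom_ext fun A => ?_
    rw [comp_whiskerRight, reassoc_of% (hΔ A), ← associator_inv_naturality_left,
      whisker_exchange_assoc, reassoc_of% (hε A), ← leftUnitor_inv_naturality_assoc]
    simp
  · refine hK.hom_ext fun A => ?_
    rw [comp_whiskerRight, reassoc_of% (hΔ A), ← associator_inv_naturality_middle,
      ← whiskerLeft_comp_assoc, hε A]
    simp
  · refine hK.hom_ext fun A => ?_
    simp only [comp_whiskerRight, reassoc_of% (hΔ A)]
    rw [← associator_inv_naturality_middle, ← whiskerLeft_comp_assoc, hΔ A,
      ← associator_inv_naturality_left_assoc, whisker_exchange_assoc, reassoc_of% (hΔ A)]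
    simp

lemma RelativeCowedge.IsCoend.existsUnique_comonObj (hK : K.IsCoend) :
    ∃! H : ComonObj K.pt, IsCoendCoalgebra K H := by
  obtain ⟨H, hH⟩ := hK.exists_comonObj
  refine ⟨H, hH, fun H' hH' => ?_⟩
  obtain ⟨h₁, h₂⟩ := (isCoendCoalgebra_iff K _).1 hH
  obtain ⟨h₁', h₂'⟩ := (isCoendCoalgebra_iff K _).1 hH'
  have hε : H'.counit = H.counit := hK.hom_ext fun A => (h₁' A).trans (h₁ A).symm
  have hΔ : H'.comul = H.comul := hK.hom_ext fun A => (h₂' A).trans (h₂ A).symm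
  cases H
  cases H'
  congr

/-- The coactions `ρ_A` are comodule structures for the coalgebra structure of the coend. -/
def comoduleLift (H : ComonObj K.pt) (hH : IsCoendCoalgebra K H) : ComoduleLift F K.pt where
  coact := coendCoaction K
  counit_coact := ((isCoendCoalgebra_iff K H).1 hH).1
  coassoc A := by
    rw [reassoc_of% ((isCoendCoalgebra_iff K H).1 hH).2 A, Iso.inv_hom_id, Category.comp_id]
  naturality := K.isModuleCoaction.naturality
  linear := K.isModuleCoaction.linear

end Coalgebra

/-! ### Comonadicity -/

section Comonadicity

open MonoidalRightAction

variable {C : Type u₁} [Category.{v₁} C] [MonoidalCategory C] [LeftRigidCategory C]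
  {B : Type u₂} [Category.{v₂} B] [MonoidalRightAction C B]
  {F : B ⥤ C} [F.RightLinear C] {H : C} [ComonObj H] (L : ComoduleLift F H)
  {U : B} {e : F.obj U ⟶ 𝟙_ C}
  (he : ∀ (A : B) (g : F.obj A ⟶ 𝟙_ C), ∃! f : A ⟶ U, F.map f ≫ e = g)

omit [LeftRigidCategory C] in
lemma ComoduleLift.map_coactionMate {X Y : C} (f : X ⟶ Y) :
    F.map (U ⊴ᵣ f) ≫ coactionMate L.coact e Y = coactionMate L.coact e X ≫ H ◁ f := by
  rw [coactionMate, coactionMate, ← reassoc_of% (L.naturality (U ⊴ᵣ f)), ← whiskerLeft_comp,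
    inducedCounit_naturality, Category.assoc, ← whiskerLeft_comp]

include he in
lemma ComoduleLift.map_moduleUnit_coactionMate (A : B) :
    F.map (moduleUnit he A) ≫ coactionMate L.coact e (F.obj A) = L.coact A := by
  rw [coactionMate, ← reassoc_of% (L.naturality (moduleUnit he A)), ← whiskerLeft_comp,
    moduleUnit_counit, whiskerLeft_id, Category.comp_id]

omit [LeftRigidCategory C] in
lemma ComoduleLift.coactionMate_counit (X : C) :
    coactionMate L.coact e X ≫ ComonObj.counit ▷ X = inducedCounit F e X ≫ (λ_ X).inv := by
  rw [coactionMate, Category.assoc, whisker_exchange, reassoc_of% (L.counit_coact (U ⊙ᵣ X)),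
    leftUnitor_inv_naturality]

omit [LeftRigidCategory C] in
lemma ComoduleLift.coactionMate_comul (X : C) :
    coactionMate L.coact e X ≫ ComonObj.comul ▷ X ≫ (α_ H H X).hom =
      L.coact (U ⊙ᵣ X) ≫ H ◁ coactionMate L.coact e X := by
  rw [coactionMate, Category.assoc, whisker_exchange_assoc, whiskerLeft_comp,
    reassoc_of% (L.coassoc (U ⊙ᵣ X)), associator_naturality_right]

lemma ComoduleLift.map_moduleUnit_map_coactionMate (X : C) :
    F.map (moduleUnit he (U ⊙ᵣ X) ≫ U ⊴ᵣ coactionMate L.coact e X) ≫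
        coactionMate L.coact e (H ⊗ X) =
      coactionMate L.coact e X ≫ ComonObj.comul ▷ X ≫ (α_ H H X).hom := by
  rw [F.map_comp, Category.assoc, L.map_coactionMate, reassoc_of% (L.map_moduleUnit_coactionMate),
    L.coactionMate_comul]

section Equalizer

variable [HasEqualizers B] (W : LeftComod H)

/-- The object of `B` which corresponds to a comodule `W`: the equalizer of the two morphisms
`U ◁ W ⟶ U ◁ (H ⊗ W)` given by the coaction of `W` and by the comultiplication of `H`. -/
noncomputable abbrev ComoduleLift.preimageObj : B :=
  equalizer (U ⊴ᵣ W.coact) (moduleUnit he (U ⊙ᵣ W.X) ≫ U ⊴ᵣ coactionMate L.coact e W.X)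

/-- The inclusion of the equalizer into `U ◁ W`. -/
noncomputable abbrev ComoduleLift.preimageι : L.preimageObj he W ⟶ U ⊙ᵣ W.X :=
  equalizer.ι _ _

/-- The canonical morphism from `F` of the equalizer to `W`. -/
noncomputable def ComoduleLift.preimageCounit : F.obj (L.preimageObj he W) ⟶ W.X :=
  F.map (L.preimageι he W) ≫ inducedCounit F e W.X

lemma ComoduleLift.preimageCounit_coact :
    L.preimageCounit he W ≫ W.coact =
      F.map (L.preimageι he W) ≫ coactionMate L.coact e W.X := by
  have h := congrArg (fun f => F.map f ≫ inducedCounit F e (H ⊗ W.X))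
    (equalizer.condition (U ⊴ᵣ W.coact)
      (moduleUnit he (U ⊙ᵣ W.X) ≫ U ⊴ᵣ coactionMate L.coact e W.X))
  simp only [F.map_comp, Category.assoc, inducedCounit_naturality,
    reassoc_of% moduleUnit_counit] at h
  rw [preimageCounit, Category.assoc, h]

lemma ComoduleLift.coact_preimageCounit :
    L.coact (L.preimageObj he W) ≫ H ◁ L.preimageCounit he W =
      L.preimageCounit he W ≫ W.coact := by
  rw [L.preimageCounit_coact, preimageCounit, whiskerLeft_comp,
    reassoc_of% (L.naturality (L.preimageι he W)), coactionMate]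

/-- A comodule `W` is the equalizer of the two morphisms `H ⊗ W ⟶ H ⊗ H ⊗ W`, and `F` preserves
the equalizer which defines the preimage of `W`. -/
lemma ComoduleLift.isIso_preimageCounit [PreservesFiniteLimits F]
    (hν : ∀ X : C, IsIso (coactionMate L.coact e X)) : IsIso (L.preimageCounit he W) := by
  let hl := isLimitForkMapOfIsLimit F _ (equalizerIsEqualizer (U ⊴ᵣ W.coact)
    (moduleUnit he (U ⊙ᵣ W.X) ≫ U ⊴ᵣ coactionMate L.coact e W.X))
  obtain ⟨t, ht⟩ := Fork.IsLimit.lift' hl (W.coact ≫ inv (coactionMate L.coact e W.X)) (by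
    rw [← cancel_mono (coactionMate L.coact e (H ⊗ W.X))]
    simp only [Category.assoc, L.map_moduleUnit_map_coactionMate, L.map_coactionMate,
      IsIso.inv_hom_id_assoc, W.coassoc])
  have ht' : t ≫ F.map (L.preimageι he W) = W.coact ≫ inv (coactionMate L.coact e W.X) := ht
  have hε : inv (coactionMate L.coact e W.X) ≫ inducedCounit F e W.X =
      ComonObj.counit ▷ W.X ≫ (λ_ W.X).hom := by
    rw [IsIso.inv_comp_eq, reassoc_of% (L.coactionMate_counit), Iso.inv_hom_id, Category.comp_id]
  refine ⟨t, ?_, ?_⟩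
  · have : Mono (F.map (L.preimageι he W)) := inferInstance
    rw [← cancel_mono (F.map (L.preimageι he W)), Category.assoc, ht',
      ← Category.assoc, L.preimageCounit_coact, Category.assoc, IsIso.hom_inv_id]
    simp
  · rw [preimageCounit, reassoc_of% ht', hε, reassoc_of% W.counit_coact, Iso.inv_hom_id]

end Equalizer

lemma ComoduleLift.moduleUnit_comp_condition {A : B} {X : C} (f : F.obj A ⟶ X) :
    (moduleUnit he A ≫ U ⊴ᵣ f) ≫ moduleUnit he (U ⊙ᵣ X) ≫ U ⊴ᵣ coactionMate L.coact e X =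
      moduleUnit he A ≫ U ⊴ᵣ (L.coact A ≫ H ◁ f) := by
  rw [Category.assoc, ← reassoc_of% moduleUnit_naturality,
    ← MonoidalRightAction.actionHomRight_comp, L.map_coactionMate,
    ← reassoc_of% moduleUnit_naturality,
    ← MonoidalRightAction.actionHomRight_comp, reassoc_of% (L.map_moduleUnit_coactionMate)]

lemma ComoduleLift.exists_lift_preimageObj [HasEqualizers B] {D : B} {W : LeftComod H}
    (g : F.obj D ⟶ W.X) (hg : L.coact D ≫ H ◁ g = g ≫ W.coact) :
    ∃ l : D ⟶ L.preimageObj he W, F.map l ≫ L.preimageCounit he W = g := by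
  refine ⟨equalizer.lift (moduleUnit he D ≫ U ⊴ᵣ g) ?_, ?_⟩
  · rw [L.moduleUnit_comp_condition he g, hg, Category.assoc,
      MonoidalRightAction.actionHomRight_comp]
  · rw [preimageCounit, ← F.map_comp_assoc, equalizer.lift_ι, F.map_comp, Category.assoc,
      inducedCounit_naturality, reassoc_of% moduleUnit_counit]

include he in
/-- A comodule morphism `F(A) ⟶ W` comes from a morphism `A ⟶ A'` if `W` is isomorphic to the
comodule `F(A')`. -/
lemma ComoduleLift.exists_map_comp_eq [HasEqualizers B] [Balanced B] [F.Faithful]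
    [PreservesFiniteLimits F] (hν : ∀ X : C, IsIso (coactionMate L.coact e X))
    {A A' : B} {W : LeftComod H} (f : F.obj A ⟶ W.X) (hf : L.coact A ≫ H ◁ f = f ≫ W.coact)
    (w : F.obj A' ⟶ W.X) (hw : L.coact A' ≫ H ◁ w = w ≫ W.coact) (hw' : IsIso w) :
    ∃ g : A ⟶ A', F.map g ≫ w = f := by
  have := L.isIso_preimageCounit he W hν
  obtain ⟨l, hl⟩ := L.exists_lift_preimageObj he f hf
  obtain ⟨j, hj⟩ := L.exists_lift_preimageObj he w hw
  have : IsIso (F.map j) := by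
    rw [← IsIso.eq_comp_inv] at hj
    rw [hj]
    infer_instance
  have : IsIso j := isIso_of_reflects_iso j F
  refine ⟨l ≫ inv j, ?_⟩
  rw [← hj, ← F.map_comp_assoc, Category.assoc, IsIso.inv_hom_id, Category.comp_id, hl]

include he in
/-- The functor `A ↦ (F(A), ρ_A)` is an equivalence, by the argument of Beck's comonadicity
theorem for the comonad `X ↦ F(U ◁ X) ≅ H ⊗ X`. -/
lemma ComoduleLift.isEquivalence_functor [HasEqualizers B] [Balanced B] [F.Faithful]
    [PreservesFiniteLimits F] (hν : ∀ X : C, IsIso (coactionMate L.coact e X)) :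
    L.functor.IsEquivalence where
  faithful := ⟨fun {A A'} f g h => F.map_injective (congrArg LeftComod.Hom.hom h)⟩
  full := ⟨fun {A A'} f => by
    obtain ⟨g, hg⟩ := L.exists_map_comp_eq he hν (A := A) (A' := A') (W := L.functor.obj A')
      f.hom f.comm (𝟙 (F.obj A')) (𝟙 (L.functor.obj A') : L.functor.obj A' ⟶ _).comm
      (inferInstanceAs (IsIso (𝟙 (F.obj A'))))
    exact ⟨g, LeftComod.hom_ext ((Category.comp_id (F.map g)).symm.trans hg)⟩⟩
  essSurj := ⟨fun W => by
    have := L.isIso_preimageCounit he W hν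
    let s := asIso (L.preimageCounit he W)
    exact ⟨L.preimageObj he W, ⟨LeftComod.mkIso s (L.coact_preimageCounit he W)⟩⟩⟩

end Comonadicity

/-! ### Equivalences of module categories -/

section ModuleEquivalence

open MonoidalRightAction Functor.LaxRightLinear Functor.OplaxRightLinear Functor.RightLinear

variable {C : Type u₁} [Category.{v₁} C] [MonoidalCategory C]
  {B : Type u₂} [Category.{v₂} B] [MonoidalRightAction C B]
  {D : Type u₃} [Category.{v₃} D] [MonoidalRightAction C D]

/-- A module functor structure from natural and coherent isomorphisms `G(W) ◁ X ≅ G(W ◁ X)`. -/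
abbrev rightLinearOfIso (G : D ⥤ B) (ℓ : ∀ (W : D) (X : C), G.obj W ⊙ᵣ X ≅ G.obj (W ⊙ᵣ X))
    (naturality_right : ∀ (W : D) {X Y : C} (f : X ⟶ Y),
      G.obj W ⊴ᵣ f ≫ (ℓ W Y).hom = (ℓ W X).hom ≫ G.map (W ⊴ᵣ f))
    (naturality_left : ∀ {W W' : D} (f : W ⟶ W') (X : C),
      G.map f ⊵ᵣ X ≫ (ℓ W' X).hom = (ℓ W X).hom ≫ G.map (f ⊵ᵣ X))
    (associativity : ∀ (W : D) (X Y : C), (ℓ W (X ⊗ Y)).hom ≫ G.map (αᵣ W X Y).hom =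
      (αᵣ (G.obj W) X Y).hom ≫ (ℓ W X).hom ⊵ᵣ Y ≫ (ℓ (W ⊙ᵣ X) Y).hom)
    (unitality : ∀ W : D, (ρᵣ[C] (G.obj W)).hom = (ℓ W (𝟙_ C)).hom ≫ G.map (ρᵣ[C] W).hom) :
    G.RightLinear C where
  μᵣ W X := (ℓ W X).hom
  μᵣ_naturality_right := naturality_right
  μᵣ_naturality_left := naturality_left
  μᵣ_associativity := associativity
  μᵣ_unitality := unitality
  δᵣ W X := (ℓ W X).inv
  δᵣ_naturality_right W X Y f := by
    rw [Iso.eq_inv_comp, ← reassoc_of% (naturality_right W f), Iso.hom_inv_id, Category.comp_id]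
  δᵣ_naturality_left f X := by
    rw [Iso.eq_inv_comp, ← reassoc_of% (naturality_left f X), Iso.hom_inv_id, Category.comp_id]
  δᵣ_associativity W X Y := by
    rw [Iso.inv_comp_eq, reassoc_of% (associativity W X Y)]
    simp
  δᵣ_unitality_inv W := by
    rw [← cancel_epi (ρᵣ[C] (G.obj W)).hom, Iso.hom_inv_id, unitality, Category.assoc,
      ← G.map_comp_assoc]
    simp
  μᵣ_comp_δᵣ W X := (ℓ W X).hom_inv_id
  δᵣ_comp_μᵣ W X := (ℓ W X).inv_hom_id

variable (E : B ≌ D) [E.functor.RightLinear C]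

/-- The isomorphism `E(E⁻¹(W) ◁ X) ≅ W ◁ X`. -/
def mapInvActionIso (W : D) (X : C) :
    E.functor.obj (E.inverse.obj W ⊙ᵣ X) ≅ W ⊙ᵣ X where
  hom := δᵣ E.functor (E.inverse.obj W) X ≫ E.counit.app W ⊵ᵣ X
  inv := E.counitInv.app W ⊵ᵣ X ≫ μᵣ E.functor (E.inverse.obj W) X
  hom_inv_id := by
    rw [Category.assoc, ← comp_actionHomLeft_assoc, ← NatTrans.comp_app, Iso.hom_inv_id]
    simp
  inv_hom_id := by
    rw [Category.assoc, μᵣ_comp_δᵣ_assoc, ← comp_actionHomLeft, ← NatTrans.comp_app,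
      Iso.inv_hom_id]
    simp

/-- The isomorphism `E⁻¹(W) ◁ X ≅ E⁻¹(W ◁ X)`. -/
noncomputable def invLineator (W : D) (X : C) :
    E.inverse.obj W ⊙ᵣ X ≅ E.inverse.obj (W ⊙ᵣ X) :=
  E.functor.preimageIso (mapInvActionIso E W X ≪≫ (E.counitIso.app (W ⊙ᵣ X)).symm)

lemma map_invLineator_hom (W : D) (X : C) :
    E.functor.map (invLineator E W X).hom = δᵣ E.functor (E.inverse.obj W) X ≫
      E.counit.app W ⊵ᵣ X ≫ E.counitInv.app (W ⊙ᵣ X) := by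
  simp [invLineator, mapInvActionIso]

lemma map_invLineator_inv (W : D) (X : C) :
    E.functor.map (invLineator E W X).inv = E.counit.app (W ⊙ᵣ X) ≫
      E.counitInv.app W ⊵ᵣ X ≫ μᵣ E.functor (E.inverse.obj W) X := by
  simp [invLineator, mapInvActionIso]

/-- The quasi-inverse of an equivalence which is a module functor is a module functor. -/
noncomputable abbrev inverseRightLinear : E.inverse.RightLinear C :=
  rightLinearOfIso E.inverse (invLineator E)
    (fun W X Y f => E.functor.map_injective (by
      rw [E.functor.map_comp, E.functor.map_comp, map_invLineator_hom, map_invLineator_hom,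
        δᵣ_naturality_right_assoc, action_exchange_assoc]
      simp))
    (fun {W W'} f X => E.functor.map_injective (by
      rw [E.functor.map_comp, E.functor.map_comp, map_invLineator_hom, map_invLineator_hom,
        δᵣ_naturality_left_assoc, ← comp_actionHomLeft_assoc]
      simp))
    (fun W X Y => E.functor.map_injective (by
      simp only [E.functor.map_comp, map_invLineator_hom, comp_actionHomLeft,
        δᵣ_naturality_left_assoc, Category.assoc]
      have hc : E.counitInv.app (W ⊙ᵣ X) ⊵ᵣ Y ≫ E.counit.app (W ⊙ᵣ X) ⊵ᵣ Y = 𝟙 _ := by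
        rw [← comp_actionHomLeft, ← NatTrans.comp_app, Iso.inv_hom_id, NatTrans.id_app,
          id_actionHomLeft]
      rw [← δᵣ_associativity_assoc]
      simp [reassoc_of% hc]))
    (fun W => E.functor.map_injective (by
      rw [E.functor.map_comp, map_invLineator_hom]
      simp))

lemma isModuleEquivalence_functor (k : Type w) [Field k] [Preadditive B] [Linear k B]
    [Preadditive D] [Linear k D] [E.functor.Additive] [E.functor.Linear k] :
    IsModuleEquivalence C k E.functor := by
  refine ⟨inferInstance, inferInstance, E.inverse, inferInstance, inferInstance,
    inverseRightLinear E, E.unitIso, E.counitIso.symm, ?_, ?_⟩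
  · intro M X
    apply E.functor.map_injective
    change E.functor.map (E.unit.app (M ⊙ᵣ X) ≫ E.inverse.map (δᵣ E.functor M X) ≫
      (invLineator E (E.functor.obj M) X).inv) = E.functor.map (𝟙 _ ≫ E.unit.app M ⊵ᵣ X)
    have h : E.functor.map (E.unit.app (M ⊙ᵣ X)) ≫ E.counit.app (E.functor.obj (M ⊙ᵣ X)) = 𝟙 _ :=
      E.functor_unit_comp (M ⊙ᵣ X)
    rw [E.functor.map_comp, E.functor.map_comp, map_invLineator_inv, Category.id_comp,
      E.counit_naturality_assoc, reassoc_of% h, E.counitInv_app_functor,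
      ← δᵣ_naturality_left_assoc]
    exact (congrArg _ (δᵣ_comp_μᵣ E.functor _ X)).trans (Category.comp_id _)
  · intro W X
    change E.counitInv.app (W ⊙ᵣ X) ≫ E.functor.map (invLineator E W X).inv ≫
      δᵣ E.functor (E.inverse.obj W) X = 𝟙 _ ≫ E.counitInv.app W ⊵ᵣ X
    rw [map_invLineator_inv]
    simp

end ModuleEquivalence

/-! ### Transfer of finiteness along equivalences -/

section Transfer

open MonoidalRightAction Functor.LaxRightLinear Functor.OplaxRightLinear Functor.RightLinear

variable {B : Type u₂} [Category.{v₂} B] {D : Type u₃} [Category.{v₃} D]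

/-- An equivalence identifies the subobjects of an object with those of its image. -/
noncomputable def subobjectOrderIso (E : B ≌ D) (X : B) :
    Subobject X ≃o Subobject (E.functor.obj X) :=
  (Subobject.lowerEquivalence (MonoOver.congr X E)).toOrderIso

lemma isArtinianObject_of_equivalence (E : B ≌ D) (X : D)
    [h : IsArtinianObject (E.inverse.obj X)] : IsArtinianObject X := by
  have : WellFoundedLT (Subobject (E.symm.functor.obj X)) := h.prop
  exact ⟨(subobjectOrderIso E.symm X).strictMono.wellFoundedLT⟩

lemma isNoetherianObject_of_equivalence (E : B ≌ D) (X : D)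
    [h : IsNoetherianObject (E.inverse.obj X)] : IsNoetherianObject X := by
  have : WellFoundedGT (Subobject (E.symm.functor.obj X)) := h.prop
  exact ⟨(subobjectOrderIso E.symm X).strictMono.wellFoundedGT⟩

lemma IsProjectiveCover.of_equivalence (E : B ≌ D) {P : B} {X : D} {p : P ⟶ E.inverse.obj X}
    (hp : IsProjectiveCover p) :
    IsProjectiveCover (E.functor.map p ≫ E.counit.app X) where
  projective := (E.map_projective_iff P).2 hp.projective
  epi := by
    have := hp.epi
    exact epi_comp _ _
  essential {Q} g hg := by
    have h : E.inverse.map (g ≫ E.functor.map p ≫ E.counit.app X) =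
        (E.inverse.map g ≫ E.unitInv.app P) ≫ p := by simp
    have : Epi (E.inverse.map (g ≫ E.functor.map p ≫ E.counit.app X)) := inferInstance
    rw [h] at this
    have h₁ := hp.essential _ this
    have h₂ : E.inverse.map g = (E.inverse.map g ≫ E.unitInv.app P) ≫ E.unit.app P := by simp
    have : Epi (E.inverse.map g) := by
      rw [h₂]
      exact epi_comp _ _
    exact E.inverse.epi_of_epi_map this

/-- A `k`-linear category equivalent to a finite category is finite. -/
lemma finiteLinearCategory_of_equivalence (k : Type w) [Field k] [Preadditive B] [Linear k B]
    [FiniteLinearCategory k B] [Preadditive D] [Linear k D] (E : B ≌ D) [E.functor.Additive]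
    [E.functor.Linear k] : FiniteLinearCategory k D := by
  let _ := FiniteLinearCategory.abelian k B
  have : HasFiniteProducts D := ⟨fun n =>
    Adjunction.hasLimitsOfShape_of_equivalence E.inverse⟩
  let hD : Abelian D := abelianOfEquivalence E.inverse
  obtain ⟨n, S, hS, hS'⟩ := FiniteLinearCategory.finite_simples k (A := B)
  exact
    { hasFiniteProducts := inferInstance
      hasKernels := inferInstance
      hasCokernels := inferInstance
      finite_simples := by
        refine ⟨n, fun i => E.functor.obj (S i), fun i => ?_, fun X hX => ?_⟩
        · have := hS i
          exact simple_obj E.functor (S i)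
        · obtain ⟨i, ⟨e⟩⟩ := hS' (E.inverse.obj X) (simple_obj E.inverse X)
          exact ⟨i, ⟨(E.counitIso.app X).symm ≪≫ E.functor.mapIso e⟩⟩
      finiteDimensional_hom := fun X Y => by
        have := FiniteLinearCategory.finiteDimensional_hom (k := k)
          (E.inverse.obj X) (E.inverse.obj Y)
        exact FiniteDimensional.of_injective (E.inverse.mapLinearMap k) E.inverse.map_injective
      artinian := fun X => by
        have := FiniteLinearCategory.artinian k (E.inverse.obj X)
        exact isArtinianObject_of_equivalence E X
      noetherian := fun X => by
        have := FiniteLinearCategory.noetherian k (E.inverse.obj X)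
        exact isNoetherianObject_of_equivalence E X
      exists_projectiveCover := fun X hX => by
        obtain ⟨P, p, hp⟩ := FiniteLinearCategory.exists_projectiveCover k (E.inverse.obj X)
          (simple_obj E.inverse X)
        exact ⟨E.functor.obj P, E.functor.map p ≫ E.counit.app X, hp.of_equivalence E⟩ }

variable {C : Type u₁} [Category.{v₁} C] [MonoidalCategory C]
  [MonoidalRightAction C B] [MonoidalRightAction C D]

/-- A category with an action which is equivalent to a module category is a module category. -/
lemma rightModuleCategory_of_equivalence (k : Type w) [Field k] [Preadditive C] [Linear k C]
    [Preadditive B] [Linear k B] [RightModuleCategory k C B] [Preadditive D] [Linear k D]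
    (E : B ≌ D) [E.functor.RightLinear C] [E.functor.Additive]
    [E.functor.Linear k] : RightModuleCategory k C D := by
  let e₁ : ∀ X : C, E.inverse ⋙ actionRight B X ⋙ E.functor ≅ actionRight D X := fun X =>
    NatIso.ofComponents (fun W => mapInvActionIso E W X) (fun {W W'} f => by
      change E.functor.map (E.inverse.map f ⊵ᵣ X) ≫ δᵣ E.functor _ X ≫ E.counit.app W' ⊵ᵣ X =
        (δᵣ E.functor _ X ≫ E.counit.app W ⊵ᵣ X) ≫ f ⊵ᵣ X
      rw [δᵣ_naturality_left_assoc, ← comp_actionHomLeft, Category.assoc, ← comp_actionHomLeft]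
      simp)
  let e₂ : ∀ W : D, actionLeft C (E.inverse.obj W) ⋙ E.functor ≅ actionLeft C W := fun W =>
    NatIso.ofComponents (fun X => mapInvActionIso E W X) (fun {X X'} f => by
      change E.functor.map (_ ⊴ᵣ f) ≫ δᵣ E.functor _ X' ≫ E.counit.app W ⊵ᵣ X' =
        (δᵣ E.functor _ X ≫ E.counit.app W ⊵ᵣ X) ≫ W ⊴ᵣ f
      rw [δᵣ_naturality_right_assoc, Category.assoc, action_exchange]
      rfl)
  have h := ‹RightModuleCategory k C B›
  have := h.additive_left
  have := h.linear_left
  have := h.additive_right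
  have := h.linear_right
  have := h.leftExact_left
  have := h.rightExact_left
  have := h.leftExact_right
  have := h.rightExact_right
  have := finiteLinearCategory_of_equivalence k E
  exact
    { additive_left := fun X => Functor.additive_of_iso (e₁ X)
      linear_left := fun X => Functor.linear_of_iso k (e₁ X)
      additive_right := fun W => Functor.additive_of_iso (e₂ W)
      linear_right := fun W => Functor.linear_of_iso k (e₂ W)
      leftExact_left := fun X => preservesFiniteLimits_of_natIso (e₁ X)
      rightExact_left := fun X => preservesFiniteColimits_of_natIso (e₁ X)
      leftExact_right := fun W => preservesFiniteLimits_of_natIso (e₂ W)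
      rightExact_right := fun W => preservesFiniteColimits_of_natIso (e₂ W) }

end Transfer

end Reconstruction

theorem theorem5 {k : Type w} [Field k]
    {C : Type u₁} [Category.{v₁} C] [Preadditive C] [Linear k C] [MonoidalCategory C]
    [RigidCategory C] [FiniteTensorCategory k C]
    {B : Type u₂} [Category.{v₂} B] [Preadditive B] [Linear k B] [MonoidalRightAction C B]
    [RightModuleCategory k C B]
    (F : B ⥤ C) [F.Additive] [F.Linear k] [F.RightLinear C] [F.Faithful]
    [PreservesFiniteLimits F] [PreservesFiniteColimits F] :
    (∃ K : RelativeCowedge (coendFunctor F) (coendPrebalancing F), K.IsCoend) ∧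
    ∀ K : RelativeCowedge (coendFunctor F) (coendPrebalancing F), K.IsCoend →
      (∃! H : ComonObj K.pt, IsCoendCoalgebra K H) ∧
      ∀ H : ComonObj K.pt, IsCoendCoalgebra K H →
        RightModuleCategory k C (LeftComod K.pt) ∧
        ∃ L : ComoduleLift F K.pt,
          (∀ A : B, L.coact A = coendCoaction K A) ∧
          L.functor ⋙ LeftComod.forget K.pt = F ∧
          (∀ (A : B) (X : C),
            Functor.OplaxRightLinear.δᵣ (L.functor ⋙ LeftComod.forget K.pt) A X =
              Functor.OplaxRightLinear.δᵣ F A X) ∧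
          IsModuleEquivalence C k L.functor := by
  have := FiniteLinearCategory.finiteDimensional_hom (k := k) (A := C)
  obtain ⟨U, e, he⟩ := exists_universal_element k F (𝟙_ C)
  refine ⟨exists_isCoend he, fun K hK => ⟨hK.existsUnique_comonObj, fun H hH => ?_⟩⟩
  let L := comoduleLift H hH
  have hν : ∀ X, IsIso (coactionMate L.coact e X) := fun X => hK.isIso_coactionMate he X
  let _ := FiniteLinearCategory.abelian k B
  have := L.isEquivalence_functor he hν
  have hadd : L.functor.Additive := ⟨LeftComod.hom_ext F.map_add⟩
  have hlin : L.functor.Linear k := ⟨fun f r => LeftComod.hom_ext (Functor.Linear.map_smul f r)⟩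
  let E := L.functor.asEquivalence
  have : E.functor.Additive := hadd
  have : E.functor.Linear k := hlin
  let _ : E.functor.RightLinear C := (inferInstance : L.functor.RightLinear C)
  exact ⟨rightModuleCategory_of_equivalence k E, L, fun _ => rfl, rfl,
    fun A X => Category.comp_id _, isModuleEquivalence_functor E k⟩
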